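/- Fix an integer $d\ge 2$. For a Young diagram $\lambda$ (identified with a partition, with rows $\lambda_1\ge\lambda_2\ge\cdots$), let $\ell(\lambda)$ be its number of rows and $\dim\lambda$ the number of standard Young tableaux of shape $\lambda$. Let $R(d,q)$ be the rectangular diagram with $d$ rows of length $q$, and for $\mu\subseteq R(d,2n)$ let $\mu^*=(2n-\mu_d,\dots,2n-\mu_1)$ be the complement of $\mu$ relative to $R(d,2n)$. Then for all real numbers $\beta>0$ and $0\le\alpha\le\beta$, $$\sum_{\substack{\lambda\vdash dn\\ \ell(\lambda)\le d}}(\dim\lambda)^{\beta}\;\sim\;\sum_{\substack{\mu\vdash dn\\ \mu\subseteq R(d,2n)}}(\dim\mu)^{\alpha}(\dim\mu^*)^{\beta-\alpha}\qquad\text{as } n\to\infty \text{ with } d,\alpha,\beta \text{ fixed},$$ that is, the ratio of the two sums tends to $1$. -/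

import Mathlib

open Filter Asymptotics

namespace YoungDiagram

/-- A standard filling of the Young diagram `μ`: a bijective labelling of its cells by
`0, 1, …, |μ| - 1` that increases strictly along every row and down every column. -/
def IsStandardFilling (μ : YoungDiagram) (T : μ.cells ≃ Fin μ.card) : Prop :=
  (∀ c c' : μ.cells, c.1.1 = c'.1.1 → c.1.2 < c'.1.2 → T c < T c') ∧
    ∀ c c' : μ.cells, c.1.2 = c'.1.2 → c.1.1 < c'.1.1 → T c < T c'

/-- The type of standard Young tableaux of shape `μ`. -/
def StandardTableau (μ : YoungDiagram) : Type :=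
  {T : μ.cells ≃ Fin μ.card // μ.IsStandardFilling T}

instance (μ : YoungDiagram) : Finite μ.StandardTableau :=
  inferInstanceAs (Finite {T : μ.cells ≃ Fin μ.card // μ.IsStandardFilling T})

/-- `dim μ`, the number of standard Young tableaux of shape `μ`. -/
noncomputable def dim (μ : YoungDiagram) : ℕ := Nat.card μ.StandardTableau

/-- There are finitely many Young diagrams with `N` cells. -/
theorem finite_setOf_card_eq (N : ℕ) : {μ : YoungDiagram | μ.card = N}.Finite := by
  have hinj : Function.Injective YoungDiagram.cells := fun μ ν h => YoungDiagram.ext h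
  refine Set.Finite.of_finite_image (f := YoungDiagram.cells) ?_ hinj.injOn
  refine ((Finset.range N ×ˢ Finset.range N).powerset.finite_toSet).subset ?_
  rintro _ ⟨μ, hμ, rfl⟩
  rw [Finset.mem_coe, Finset.mem_powerset]
  rintro ⟨i, j⟩ hij
  have hij' : (i, j) ∈ μ := (YoungDiagram.mem_cells _).1 hij
  have hμ' : μ.cells.card = N := hμ
  have h1 : μ.rowLen i ≤ N := by
    rw [YoungDiagram.rowLen_eq_card, ← hμ']
    exact Finset.card_le_card (Finset.filter_subset _ _)
  have h2 : μ.colLen j ≤ N := by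
    rw [YoungDiagram.colLen_eq_card, ← hμ']
    exact Finset.card_le_card (Finset.filter_subset _ _)
  have h3 := YoungDiagram.mem_iff_lt_rowLen.1 hij'
  have h4 := YoungDiagram.mem_iff_lt_colLen.1 hij'
  simp only [Finset.mem_product, Finset.mem_range]
  omega

/-- The finite set of Young diagrams with `N` cells, that is, of partitions `μ ⊢ N`. -/
noncomputable def ofSize (N : ℕ) : Finset YoungDiagram := (finite_setOf_card_eq N).toFinset

@[simp] theorem mem_ofSize {N : ℕ} {μ : YoungDiagram} : μ ∈ ofSize N ↔ μ.card = N := by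
  simp [ofSize]

/-- The rectangular Young diagram `R(d, q)` with `d` rows of length `q`. -/
def rectangle (d q : ℕ) : YoungDiagram where
  cells := Finset.range d ×ˢ Finset.range q
  isLowerSet := by
    rintro ⟨i, j⟩ ⟨i', j'⟩ ⟨hi, hj⟩ h
    simp only [Finset.coe_product, Finset.coe_range, Set.mem_prod, Set.mem_Iio] at h hi hj ⊢
    omega

/-- The complement `μ* = (q - μ_d, …, q - μ_1)` of `μ ⊆ R(d, q)` relative to `R(d, q)`.
Rows are numbered from `0`, so row `i < d` of `μ*` has length `q - μ.rowLen (d - 1 - i)`. -/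
def complement (d q : ℕ) (μ : YoungDiagram) : YoungDiagram where
  cells := (Finset.range d ×ˢ Finset.range q).filter
    fun c => c.2 < q - μ.rowLen (d - 1 - c.1)
  isLowerSet := by
    rintro ⟨i, j⟩ ⟨i', j'⟩ ⟨hi, hj⟩ h
    simp only [Finset.coe_filter, Finset.mem_product, Finset.mem_range, Set.mem_ofPred_eq]
      at h hi hj ⊢
    have := μ.rowLen_anti (d - 1 - i) (d - 1 - i') (by omega)
    omega

theorem rowLen_complement (d q : ℕ) (μ : YoungDiagram) {i : ℕ} (hi : i < d) :
    (complement d q μ).rowLen i = q - μ.rowLen (d - 1 - i) := by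
  refine eq_of_forall_lt_iff fun j => ?_
  rw [← YoungDiagram.mem_iff_lt_rowLen, ← YoungDiagram.mem_cells]
  simp only [complement, Finset.mem_filter, Finset.mem_product, Finset.mem_range]
  omega

/-- `S(d, N; β)`: the sum of `(dim l) ^ β` over all partitions `l ⊢ N` with at most `d` rows
(the number of rows of a diagram is the length of its column `0`). -/
noncomputable def dimPowerSum (d N : ℕ) (β : ℝ) : ℝ :=
  ∑ l ∈ (ofSize N).filter (fun l => l.colLen 0 ≤ d), (l.dim : ℝ) ^ β

open Classical in
/-- The sum of `(dim μ) ^ α * (dim μ*) ^ (β - α)` over all `μ ⊢ d n` contained in `R(d, 2n)`,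
where `μ*` is the complement of `μ` relative to `R(d, 2n)`. -/
noncomputable def rectanglePowerSum (d n : ℕ) (α β : ℝ) : ℝ :=
  ∑ μ ∈ (ofSize (d * n)).filter (fun μ => μ ≤ rectangle d (2 * n)),
    (μ.dim : ℝ) ^ α * ((complement d (2 * n) μ).dim : ℝ) ^ (β - α)

end YoungDiagram

/-! Both sums are concentrated on diagrams whose rows all have length close to `n`, and for such
diagrams `dim μ` and `dim μ*` are asymptotically equal, uniformly in `μ`.

The tool is Frobenius' formula `dim μ = |μ|! ∏_{i<j} (l_j - l_i) / ∏ l_i!`, where `l_i` is the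
`i`-th row length counted from the bottom, plus `i` (`ncard_fillings_mul_prod_factorial`,
`dim_mul_prod_factorial`). It is proved by induction on the number of cells from the branching rule
and a Vandermonde identity.

Near the rectangle: complementation reflects the `l_i`, so the Vandermonde product is unchanged and
only the factorials matter. If `a` and `b` are corresponding values for `μ` and `μ*`, then `a + b +
1 = 2n + d`, and `log (a!/b!)` is `(a - b) log n` up to order `T/n + T^3/n^2` for fixed `d`, when `1
≤ T` and `|a - b| ≤ T`. The main terms add up to zero because `μ` and `μ*` have the same size
(`abs_log_dim_complement_sub_le`).

Far from the rectangle: some row is shorter than `n - k`, which costs a factor `exp(-k^2/(2n))`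
against the dimension of `R(d, n)`, up to a power of `n` (`log_dim_le_of_short_row`). There are only
polynomially many diagrams, so the far part is negligible (`farSum_le`).

The choice `k ≈ n^(3/5)` serves both regimes: `k^3/n^2 ≈ n^(-1/5)` tends to zero while `k^2/n ≈
n^(1/5)` beats every multiple of `log n`. Any exponent strictly between 1/2 and 2/3 would do. -/

namespace YoungDiagram

/-! ### Standard fillings and the branching rule. -/

/-- `c` precedes `c'` in the same row or in the same column. -/
def CellBefore (c c' : ℕ × ℕ) : Prop :=
  (c.1 = c'.1 ∧ c.2 < c'.2) ∨ (c.2 = c'.2 ∧ c.1 < c'.1)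

/-- Fillings of a finite set `s` of cells by `0, …, |s| - 1`, strictly increasing along rows and
columns, extended by `0` outside `s`. -/
def fillings (s : Finset (ℕ × ℕ)) : Set (ℕ × ℕ → ℕ) :=
  {f | (∀ c, c ∉ s → f c = 0) ∧ (∀ c ∈ s, ∀ c' ∈ s, f c = f c' → c = c') ∧
    (∀ c ∈ s, f c < s.card) ∧ ∀ c ∈ s, ∀ c' ∈ s, CellBefore c c' → f c < f c'}

theorem finite_fillings (s : Finset (ℕ × ℕ)) : (fillings s).Finite := by
  have : Function.Injective
      fun (f : fillings s) (c : s) => (⟨f.1 c, f.2.2.2.1 c c.2⟩ : Fin s.card) := by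
    intro f g h
    refine Subtype.ext (funext fun c => ?_)
    by_cases hc : c ∈ s
    · simpa using congrFun h ⟨c, hc⟩
    · rw [f.2.1 c hc, g.2.1 c hc]
  have := Finite.of_injective _ this
  exact Set.toFinite _

/-- Fillings of different cell sets are functions of one common type, so a cell can be removed
without transporting along equalities of `Fin` types. -/
theorem dim_eq_ncard_fillings (μ : YoungDiagram) : μ.dim = (fillings μ.cells).ncard := by
  classical
  have hcard : μ.cells.card = μ.card := rfl
  rw [← Nat.card_coe_set_eq]
  refine Nat.card_congr (Equiv.ofBijective
    (fun T => ⟨fun c => if h : c ∈ μ.cells then (T.1 ⟨c, h⟩ : ℕ) else 0, ?_, ?_, ?_, ?_⟩) ⟨?_, ?_⟩)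
  · intro c hc
    simp only [hc, dite_false]
  · intro c hc c' hc' h
    simp only [hc, hc', dite_true] at h
    simpa using T.1.injective (Fin.ext h)
  · intro c hc
    simp only [hc, dite_true]
    exact (T.1 ⟨c, hc⟩).2
  · intro c hc c' hc' h
    simp only [hc, hc', dite_true]
    rcases h with h | h
    · exact T.2.1 ⟨c, hc⟩ ⟨c', hc'⟩ h.1 h.2
    · exact T.2.2 ⟨c, hc⟩ ⟨c', hc'⟩ h.1 h.2
  · intro T T' h
    refine Subtype.ext (Equiv.ext fun c => Fin.ext ?_)
    have := congrFun (congrArg Subtype.val h) c.1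
    simpa using this
  · rintro ⟨f, h0, hinj, hlt, hmono⟩
    have hbij : Function.Bijective
        fun c : μ.cells => (⟨f c, hlt c c.2⟩ : Fin μ.card) := by
      rw [Fintype.bijective_iff_injective_and_card]
      refine ⟨fun c c' h => Subtype.ext (hinj c c.2 c' c'.2 (Fin.ext_iff.1 h)), ?_⟩
      rw [Fintype.card_coe, Fintype.card_fin]
    refine ⟨⟨Equiv.ofBijective _ hbij, fun c c' h1 h2 => ?_, fun c c' h1 h2 => ?_⟩, ?_⟩
    · exact hmono c c.2 c' c'.2 (Or.inl ⟨h1, h2⟩)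
    · exact hmono c c.2 c' c'.2 (Or.inr ⟨h1, h2⟩)
    · refine Subtype.ext (funext fun c => ?_)
      by_cases hc : c ∈ μ.cells
      · simp only [hc, dite_true, Equiv.ofBijective_apply]
      · simp only [hc, dite_false, h0 c hc]

theorem ncard_fillings_empty : (fillings ∅).ncard = 1 := by
  rw [Set.ncard_eq_one]
  refine ⟨fun _ => 0, ?_⟩
  ext f
  simp [fillings, funext_iff]

open Classical in
/-- The cells of `s` that precede no other cell of `s`. -/
noncomputable def maximalCells (s : Finset (ℕ × ℕ)) : Finset (ℕ × ℕ) :=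
  s.filter fun c => ∀ c' ∈ s, ¬ CellBefore c c'

theorem mem_maximalCells {s : Finset (ℕ × ℕ)} {c : ℕ × ℕ} :
    c ∈ maximalCells s ↔ c ∈ s ∧ ∀ c' ∈ s, ¬ CellBefore c c' := by
  classical
  exact Finset.mem_filter

theorem exists_last_cell {s : Finset (ℕ × ℕ)} {N : ℕ} (hs : s.card = N + 1) {f : ℕ × ℕ → ℕ}
    (hf : f ∈ fillings s) : ∃ c ∈ maximalCells s, f c = N := by
  obtain ⟨-, hinj, hlt, hmono⟩ := hf
  have himg : s.image f = Finset.range (N + 1) := by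
    refine Finset.eq_of_subset_of_card_le (fun x hx => ?_) ?_
    · obtain ⟨c, hc, rfl⟩ := Finset.mem_image.1 hx
      exact Finset.mem_range.2 (hs ▸ hlt c hc)
    · rw [Finset.card_image_of_injOn (fun c hc c' hc' h => hinj c hc c' hc' h), hs,
        Finset.card_range]
  have : N ∈ s.image f := himg ▸ Finset.mem_range.2 N.lt_succ_self
  obtain ⟨c, hc, hcN⟩ := Finset.mem_image.1 this
  refine ⟨c, mem_maximalCells.2 ⟨hc, fun c' hc' h => ?_⟩, hcN⟩
  have h1 := hmono c hc c' hc' h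
  have h2 := hlt c' hc'
  omega

theorem update_mem_fillings {s : Finset (ℕ × ℕ)} {N : ℕ} (hs : s.card = N + 1) {c : ℕ × ℕ}
    (hc : c ∈ maximalCells s) {g : ℕ × ℕ → ℕ} (hg : g ∈ fillings (s.erase c)) :
    Function.update g c N ∈ fillings s := by
  obtain ⟨hcs, hmax⟩ := mem_maximalCells.1 hc
  obtain ⟨h0, hinj, hlt, hmono⟩ := hg
  rw [Finset.card_erase_of_mem hcs, hs, Nat.add_sub_cancel] at hlt
  refine ⟨fun a ha => ?_, fun a ha b hb hab => ?_, fun a ha => ?_, fun a ha b hb hab => ?_⟩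
  · have : a ≠ c := fun h => ha (h ▸ hcs)
    rw [Function.update_of_ne this]
    exact h0 a (fun h => ha (Finset.mem_of_mem_erase h))
  · by_cases hac : a = c <;> by_cases hbc : b = c
    · rw [hac, hbc]
    · subst hac
      rw [Function.update_self, Function.update_of_ne hbc] at hab
      exact absurd (hlt b (Finset.mem_erase.2 ⟨hbc, hb⟩)) (by omega)
    · subst hbc
      rw [Function.update_self, Function.update_of_ne hac] at hab
      exact absurd (hlt a (Finset.mem_erase.2 ⟨hac, ha⟩)) (by omega)
    · rw [Function.update_of_ne hac, Function.update_of_ne hbc] at hab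
      exact hinj a (Finset.mem_erase.2 ⟨hac, ha⟩) b (Finset.mem_erase.2 ⟨hbc, hb⟩) hab
  · by_cases hac : a = c
    · subst hac
      rw [Function.update_self]; omega
    · rw [Function.update_of_ne hac]
      have := hlt a (Finset.mem_erase.2 ⟨hac, ha⟩)
      omega
  · by_cases hac : a = c
    · exact absurd hab (hac ▸ hmax b hb)
    · rw [Function.update_of_ne hac]
      have h1 := Finset.mem_erase.2 ⟨hac, ha⟩
      by_cases hbc : b = c
      · subst hbc
        rw [Function.update_self]
        exact hlt a h1
      · rw [Function.update_of_ne hbc]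
        exact hmono a h1 b (Finset.mem_erase.2 ⟨hbc, hb⟩) hab

theorem update_zero_mem_fillings {s : Finset (ℕ × ℕ)} {N : ℕ} (hs : s.card = N + 1) {c : ℕ × ℕ}
    (hc : c ∈ s) {f : ℕ × ℕ → ℕ} (hf : f ∈ fillings s) (hfc : f c = N) :
    Function.update f c 0 ∈ fillings (s.erase c) := by
  obtain ⟨h0, hinj, hlt, hmono⟩ := hf
  refine ⟨fun a ha => ?_, fun a ha b hb hab => ?_, fun a ha => ?_, fun a ha b hb hab => ?_⟩
  · by_cases hac : a = c
    · rw [hac, Function.update_self]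
    · rw [Function.update_of_ne hac]
      exact h0 a (fun h => ha (Finset.mem_erase.2 ⟨hac, h⟩))
  · rw [Finset.mem_erase] at ha hb
    rw [Function.update_of_ne ha.1, Function.update_of_ne hb.1] at hab
    exact hinj a ha.2 b hb.2 hab
  · rw [Finset.mem_erase] at ha
    rw [Function.update_of_ne ha.1, Finset.card_erase_of_mem hc]
    have h1 := hlt a ha.2
    have h2 : f a ≠ N := fun h => ha.1 (hinj a ha.2 c hc (h.trans hfc.symm))
    omega
  · rw [Finset.mem_erase] at ha hb
    rw [Function.update_of_ne ha.1, Function.update_of_ne hb.1]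
    exact hmono a ha.2 b hb.2 hab

/-- The branching rule. The largest label `N` sits on a maximal cell, and erasing that cell is
inverted by writing `N` back into it; the position of `N` makes the union disjoint. -/
theorem ncard_fillings_eq_sum {s : Finset (ℕ × ℕ)} {N : ℕ} (hs : s.card = N + 1) :
    (fillings s).ncard = ∑ c ∈ maximalCells s, (fillings (s.erase c)).ncard := by
  classical
  have hU : (finite_fillings s).toFinset = (maximalCells s).biUnion fun c =>
      (finite_fillings (s.erase c)).toFinset.image fun g => Function.update g c N := by
    ext f
    simp only [Set.Finite.mem_toFinset, Finset.mem_biUnion, Finset.mem_image]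
    constructor
    · intro hf
      obtain ⟨c, hc, hfc⟩ := exists_last_cell hs hf
      refine ⟨c, hc, Function.update f c 0,
        update_zero_mem_fillings hs (mem_maximalCells.1 hc).1 hf hfc, ?_⟩
      rw [Function.update_idem, ← hfc, Function.update_eq_self]
    · rintro ⟨c, hc, g, hg, rfl⟩
      exact update_mem_fillings hs hc hg
  rw [Set.ncard_eq_toFinset_card _ (finite_fillings s), hU, Finset.card_biUnion]
  · refine Finset.sum_congr rfl fun c hc => ?_
    rw [Set.ncard_eq_toFinset_card _ (finite_fillings _), Finset.card_image_of_injOn]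
    intro g hg g' hg' h
    have hg0 : g c = 0 := (Set.Finite.mem_toFinset _ |>.1 hg).1 c (Finset.notMem_erase c s)
    have hg0' : g' c = 0 := (Set.Finite.mem_toFinset _ |>.1 hg').1 c (Finset.notMem_erase c s)
    have := congrArg (fun f => Function.update f c 0) h
    simp only [Function.update_idem] at this
    rwa [← hg0, Function.update_eq_self, hg0, ← hg0', Function.update_eq_self] at this
  · intro c hc c' hc' hne
    rw [Function.onFun, Finset.disjoint_left]
    intro f hf hf'
    obtain ⟨g, hg, rfl⟩ := Finset.mem_image.1 hf
    obtain ⟨g', hg', h⟩ := Finset.mem_image.1 hf'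
    rw [Set.Finite.mem_toFinset] at hg hg'
    obtain ⟨-, hinj, -⟩ := update_mem_fillings hs hc hg
    refine hne (hinj c (mem_maximalCells.1 hc).1 c' (mem_maximalCells.1 hc').1 ?_)
    rw [Function.update_self, ← h, Function.update_self]

/-! ### The Vandermonde identity behind Frobenius' formula. -/

theorem det_descPochhammer_eq_det_vandermonde {d : ℕ} (x : Fin d → ℝ) :
    (Matrix.of fun i j : Fin d => (descPochhammer ℝ j).eval (x i)).det =
      (Matrix.vandermonde x).det := by
  symm
  apply Matrix.det_eval_matrixOfPolynomials_eq_det_vandermonde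
  · intro i; exact descPochhammer_natDegree ℝ i
  · intro i; exact monic_descPochhammer ℝ i

theorem mul_descPochhammer_eval_sub_one (x : ℝ) (j : ℕ) :
    x * (descPochhammer ℝ j).eval (x - 1) = (x - j) * (descPochhammer ℝ j).eval x := by
  have h1 := congrArg (Polynomial.eval x) (descPochhammer_succ_left ℝ j)
  have h2 := congrArg (Polynomial.eval x) (descPochhammer_succ_right ℝ j)
  simp at h1 h2
  rw [← h1, h2]; ring

/-- In the Leibniz expansion the term of each permutation `σ` is multiplied by `∑ k, (x (σ k) - y
k)`, which does not depend on `σ`. -/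
theorem sum_det_updateRow_mul {d : ℕ} (A : Matrix (Fin d) (Fin d) ℝ) (x y : Fin d → ℝ) :
    ∑ t, (A.updateRow t fun j => (x t - y j) * A t j).det =
      (∑ i, x i - ∑ j, y j) * A.det := by
  simp only [Matrix.det_apply']
  rw [Finset.sum_comm, Finset.mul_sum]
  refine Finset.sum_congr rfl fun σ _ => ?_
  have key : ∀ k : Fin d, ∏ i, A.updateRow (σ k) (fun j => (x (σ k) - y j) * A (σ k) j) (σ i) i =
      (x (σ k) - y k) * ∏ i, A (σ i) i := by
    intro k
    rw [← Finset.mul_prod_erase _ _ (Finset.mem_univ k),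
      ← Finset.mul_prod_erase _ (fun i => A (σ i) i) (Finset.mem_univ k),
      Matrix.updateRow_self, mul_assoc]
    congr 2
    refine Finset.prod_congr rfl fun i hi => ?_
    rw [Matrix.updateRow_ne (fun h => (Finset.mem_erase.1 hi).1 (σ.injective h))]
  rw [← Equiv.sum_comp σ]
  simp only [key]
  rw [← Equiv.sum_comp σ x, ← Finset.sum_sub_distrib, Finset.sum_mul]
  exact Finset.sum_congr rfl fun k _ => by ring

/-- In the basis of falling factorials, lowering `x t` by one and multiplying by `x t` just
multiplies the entry in column `j` of row `t` by `x t - j`, so `sum_det_updateRow_mul` applies. -/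
theorem sum_mul_det_vandermonde_update {d : ℕ} (x : Fin d → ℝ) :
    ∑ t, x t * (Matrix.vandermonde (Function.update x t (x t - 1))).det =
      (∑ i, x i - ∑ j : Fin d, (j : ℝ)) * (Matrix.vandermonde x).det := by
  rw [← det_descPochhammer_eq_det_vandermonde x,
    ← sum_det_updateRow_mul _ x (fun j => ((j : ℕ) : ℝ))]
  refine Finset.sum_congr rfl fun t _ => ?_
  rw [← det_descPochhammer_eq_det_vandermonde]
  have : (Matrix.of fun i j : Fin d => (descPochhammer ℝ j).eval (Function.update x t (x t - 1) i))
      = (Matrix.of fun i j : Fin d => (descPochhammer ℝ j).eval (x i)).updateRow t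
        fun j => (descPochhammer ℝ j).eval (x t - 1) := by
    ext i j
    by_cases h : i = t
    · subst h; simp
    · simp [h]
  rw [this, ← Matrix.det_updateRow_smul]
  congr 2
  ext j
  simp [mul_descPochhammer_eval_sub_one]

/-! ### Frobenius' formula. Rows are listed from the bottom, so that the numbers `f i + i` increase
and their differences are positive. -/

open Nat (factorial)

/-- The cells of the diagram whose rows, from the last one up, have lengths `f 0, f 1, …`. -/
def rowCells {d : ℕ} (f : Fin d → ℕ) : Finset (ℕ × ℕ) :=
  Finset.univ.biUnion fun i => {(i.rev : ℕ)} ×ˢ Finset.range (f i)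

theorem mem_rowCells {d : ℕ} {f : Fin d → ℕ} {c : ℕ × ℕ} :
    c ∈ rowCells f ↔ ∃ i : Fin d, c.1 = i.rev ∧ c.2 < f i := by
  simp only [rowCells, Finset.mem_biUnion, Finset.mem_univ, true_and, Finset.mem_product,
    Finset.mem_singleton, Finset.mem_range]

theorem rev_mem_rowCells {d : ℕ} {f : Fin d → ℕ} {i : Fin d} {j : ℕ} :
    ((i.rev : ℕ), j) ∈ rowCells f ↔ j < f i := by
  rw [mem_rowCells]
  constructor
  · rintro ⟨i', h, hj⟩
    rwa [Fin.rev_injective (Fin.ext h)]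
  · exact fun h => ⟨i, rfl, h⟩

theorem card_rowCells {d : ℕ} (f : Fin d → ℕ) : (rowCells f).card = ∑ i, f i := by
  rw [rowCells, Finset.card_biUnion]
  · simp
  · intro i _ j _ hij
    rw [Function.onFun, Finset.disjoint_left]
    intro c hc hc'
    simp only [Finset.mem_product, Finset.mem_singleton] at hc hc'
    exact hij (Fin.rev_injective (Fin.ext (hc.1.symm.trans hc'.1)))

/-- The last cell of row `t` can be removed. -/
def IsCornerRow {d : ℕ} (f : Fin d → ℕ) (t : Fin d) : Prop :=
  0 < f t ∧ ∀ i : Fin d, (i : ℕ) + 1 = t → f i < f t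

theorem maximalCells_rowCells {d : ℕ} {f : Fin d → ℕ} (hf : Monotone f)
    [DecidablePred (IsCornerRow f)] :
    maximalCells (rowCells f) =
      (Finset.univ.filter (IsCornerRow f)).image fun t => ((t.rev : ℕ), f t - 1) := by
  ext ⟨a, b⟩
  rw [mem_maximalCells, Finset.mem_image]
  constructor
  · rintro ⟨hc, hmax⟩
    obtain ⟨t, ha, hb⟩ := mem_rowCells.1 hc
    obtain rfl : a = t.rev := ha
    change b < f t at hb
    have hb' : b = f t - 1 := by
      by_contra hne
      exact hmax (t.rev, f t - 1) (rev_mem_rowCells.2 (by omega)) (Or.inl ⟨rfl, by dsimp; omega⟩)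
    refine ⟨t, Finset.mem_filter.2 ⟨Finset.mem_univ _, by omega, fun i hi => ?_⟩, by rw [hb']⟩
    by_contra hlt
    refine hmax (i.rev, b) (rev_mem_rowCells.2 (by omega)) (Or.inr ⟨rfl, ?_⟩)
    have := i.2; have := t.2
    simp only [Fin.val_rev]
    omega
  · rintro ⟨t, ht, h⟩
    obtain ⟨-, hpos, hcor⟩ := Finset.mem_filter.1 ht
    obtain ⟨rfl, rfl⟩ := Prod.mk.injEq _ _ _ _ ▸ h
    refine ⟨rev_mem_rowCells.2 (by omega), ?_⟩
    rintro ⟨a', b'⟩ hc' hbef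
    obtain ⟨i, ha, hb⟩ := mem_rowCells.1 hc'
    obtain rfl : a' = i.rev := ha
    change b' < f i at hb
    rcases hbef with ⟨h1, h2⟩ | ⟨h1, h2⟩
    · obtain rfl : t = i := Fin.rev_injective (Fin.ext h1)
      dsimp at h2
      omega
    · dsimp at h1
      simp only [Fin.val_rev] at h2
      have hit : i < t := by
        rw [Fin.lt_def]; have := i.2; omega
      have := hcor ⟨t - 1, by omega⟩ (by rw [Fin.lt_def] at hit; dsimp; omega)
      have h3 : f i ≤ f ⟨t - 1, by omega⟩ :=
        hf (by rw [Fin.le_def]; rw [Fin.lt_def] at hit; dsimp; omega)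
      omega

theorem rowCells_erase {d : ℕ} (f : Fin d → ℕ) (t : Fin d) :
    (rowCells f).erase ((t.rev : ℕ), f t - 1) = rowCells (Function.update f t (f t - 1)) := by
  ext ⟨a, b⟩
  rw [Finset.mem_erase]
  by_cases ha : ∃ i : Fin d, a = i.rev
  · obtain ⟨i, rfl⟩ := ha
    rw [rev_mem_rowCells, rev_mem_rowCells]
    by_cases hi : i = t
    · subst hi
      rw [Function.update_self]
      simp only [ne_eq, Prod.mk.injEq, true_and]
      omega
    · rw [Function.update_of_ne hi]
      refine ⟨fun h => h.2, fun h => ⟨fun h' => hi ?_, h⟩⟩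
      exact Fin.rev_injective (Fin.ext (Prod.mk.injEq _ _ _ _ ▸ h').1)
  · rw [mem_rowCells, mem_rowCells]
    exact ⟨fun h => absurd ⟨_, h.2.choose_spec.1⟩ ha, fun h => absurd ⟨_, h.choose_spec.1⟩ ha⟩

theorem monotone_update_of_isCornerRow {d : ℕ} {f : Fin d → ℕ} (hf : Monotone f) {t : Fin d}
    (ht : IsCornerRow f t) : Monotone (Function.update f t (f t - 1)) := by
  intro a b hab
  by_cases ha : a = t <;> by_cases hb : b = t
  · rw [ha, hb]
  · subst ha
    rw [Function.update_self, Function.update_of_ne hb]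
    exact (Nat.sub_le _ _).trans (hf hab)
  · subst hb
    rw [Function.update_self, Function.update_of_ne ha]
    have hlt : (a : ℕ) < b := lt_of_le_of_ne hab (fun h => ha (Fin.ext h))
    have h1 := ht.2 ⟨b - 1, by omega⟩ (by dsimp; omega)
    have h2 : f a ≤ f ⟨b - 1, by omega⟩ := hf (by rw [Fin.le_def]; dsimp; omega)
    omega
  · rw [Function.update_of_ne ha, Function.update_of_ne hb]
    exact hf hab

/-- The determinant `∏_{i < j} (l_j - l_i)` for `l_i = f i + i`. -/
noncomputable def rowVandermonde {d : ℕ} (f : Fin d → ℕ) : ℝ :=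
  (Matrix.vandermonde fun i => ((f i + i : ℕ) : ℝ)).det

theorem rowVandermonde_eq_prod {d : ℕ} (f : Fin d → ℕ) :
    rowVandermonde f =
      ∏ i : Fin d, ∏ j ∈ Finset.Ioi i, (((f j + j : ℕ) : ℝ) - ((f i + i : ℕ) : ℝ)) :=
  Matrix.det_vandermonde _

/-- Base case of the induction: at the nodes `0, …, d - 1` the matrix of falling factorials is
triangular with diagonal entries `i!`. -/
theorem rowVandermonde_zero (d : ℕ) :
    rowVandermonde (fun _ : Fin d => 0) = ∏ i : Fin d, (factorial (i : ℕ) : ℝ) := by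
  rw [rowVandermonde, ← det_descPochhammer_eq_det_vandermonde, Matrix.det_of_isLowerTriangular]
  · refine Finset.prod_congr rfl fun i _ => ?_
    rw [Matrix.of_apply, zero_add, descPochhammer_eval_eq_descFactorial, Nat.descFactorial_self]
  · intro i j hij
    rw [Matrix.of_apply, zero_add, descPochhammer_eval_eq_descFactorial,
      Nat.descFactorial_of_lt (by exact hij), Nat.cast_zero]

theorem cast_update_add {d : ℕ} {f : Fin d → ℕ} {t : Fin d} (ht : 0 < f t) :
    (fun i => ((Function.update f t (f t - 1) i + i : ℕ) : ℝ)) =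
      Function.update (fun i => ((f i + i : ℕ) : ℝ)) t (((f t + t : ℕ) : ℝ) - 1) := by
  funext i
  by_cases h : i = t
  · subst h
    rw [Function.update_self, Function.update_self, ← Nat.sub_add_comm (show 1 ≤ f i from ht),
      Nat.cast_sub (by omega), Nat.cast_one]
  · rw [Function.update_of_ne h, Function.update_of_ne h]

/-- A row fails to be a corner row either because it is the bottom row and empty, and then the
prefactor is zero, or because it equals the row below, and then lowering its node makes two nodes
coincide. -/
theorem mul_det_vandermonde_update_eq_zero {d : ℕ} {f : Fin d → ℕ} (hf : Monotone f) {t : Fin d}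
    (ht : ¬ IsCornerRow f t) :
    ((f t + t : ℕ) : ℝ) * (Matrix.vandermonde (Function.update (fun i => ((f i + i : ℕ) : ℝ)) t
      (((f t + t : ℕ) : ℝ) - 1))).det = 0 := by
  have key : f t + t = 0 ∨ ∃ i : Fin d, (i : ℕ) + 1 = t ∧ f i = f t := by
    by_cases h0 : (t : ℕ) = 0
    · left
      by_contra hne
      exact ht ⟨by omega, fun i hi => by omega⟩
    · right
      have hlt : (⟨t - 1, by omega⟩ : Fin d) ≤ t := by rw [Fin.le_def]; dsimp; omega
      refine ⟨⟨t - 1, by omega⟩, by dsimp; omega, le_antisymm (hf hlt) ?_⟩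
      by_contra hne
      refine ht ⟨by omega, fun i hi => ?_⟩
      rw [show i = ⟨t - 1, by omega⟩ from Fin.ext (by dsimp; omega)]
      omega
  rcases key with h | ⟨i, hi, hfi⟩
  · rw [h, Nat.cast_zero, zero_mul]
  · have hne : i ≠ t := fun h => by rw [h] at hi; omega
    rw [Matrix.det_vandermonde_eq_zero_iff.2, mul_zero]
    refine ⟨i, t, ?_, hne⟩
    rw [Function.update_self, Function.update_of_ne hne, hfi, ← hi]
    push_cast; ring

theorem prod_factorial_update {d : ℕ} {f : Fin d → ℕ} {t : Fin d} (ht : 0 < f t) :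
    ∏ i, (factorial (f i + i) : ℝ) = ((f t + t : ℕ) : ℝ) *
      ∏ i, (factorial (Function.update f t (f t - 1) i + i) : ℝ) := by
  rw [← Finset.mul_prod_erase _ _ (Finset.mem_univ t),
    ← Finset.mul_prod_erase _ (fun i => (factorial (Function.update f t (f t - 1) i + i) : ℝ))
      (Finset.mem_univ t), ← mul_assoc]
  congr 1
  · rw [Function.update_self, show f t + t = (f t - 1 + t) + 1 by omega, Nat.factorial_succ]
    push_cast; ring
  · refine Finset.prod_congr rfl fun i hi => ?_
    rw [Function.update_of_ne (Finset.mem_erase.1 hi).1]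

/-- Frobenius' formula for the number of standard fillings. -/
theorem ncard_fillings_mul_prod_factorial {d : ℕ} (N : ℕ) : ∀ f : Fin d → ℕ, Monotone f →
    ∑ i, f i = N → ((fillings (rowCells f)).ncard : ℝ) * ∏ i, (factorial (f i + i) : ℝ) =
      factorial N * rowVandermonde f := by
  classical
  induction N with
  | zero =>
    intro f _ hN
    have hf0 : f = fun _ => 0 := funext fun i => by
      simpa using Finset.sum_eq_zero_iff.1 hN i (Finset.mem_univ i)
    have hcells : rowCells f = ∅ := Finset.card_eq_zero.1 (by rw [card_rowCells, hN])
    rw [hcells, ncard_fillings_empty, hf0, rowVandermonde_zero]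
    simp
  | succ N ih =>
    intro f hf hN
    set x : Fin d → ℝ := fun i => ((f i + i : ℕ) : ℝ) with hx
    -- Removing a cell from row `t` divides `∏ i, (f i + i)!` by `x t`; this produces the weight `x
    -- t` of the Vandermonde identity.
    have hterm : ∀ t, IsCornerRow f t →
        ((fillings (rowCells (Function.update f t (f t - 1)))).ncard : ℝ) *
          ∏ i, (factorial (f i + i) : ℝ) =
        factorial N * (x t * (Matrix.vandermonde (Function.update x t (x t - 1))).det) := by
      intro t ht
      have hsum : ∑ i, Function.update f t (f t - 1) i = N := by
        have h1 := Finset.sum_update_of_mem (Finset.mem_univ t) f (f t - 1)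
        have h2 := Finset.add_sum_erase Finset.univ f (Finset.mem_univ t)
        rw [Finset.sdiff_singleton_eq_erase] at h1
        have := ht.1
        omega
      have h := ih _ (monotone_update_of_isCornerRow hf ht) hsum
      rw [rowVandermonde, cast_update_add ht.1] at h
      rw [prod_factorial_update ht.1, mul_left_comm, h]
      ring
    have hcard : (rowCells f).card = N + 1 := by rw [card_rowCells, hN]
    rw [ncard_fillings_eq_sum hcard, maximalCells_rowCells hf, Finset.sum_image, Nat.cast_sum,
      Finset.sum_mul]
    · simp only [rowCells_erase]
      -- The sum over corner rows extends to all rows since the other terms vanish. The identity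
      -- then contributes `∑ x i - ∑ j = N + 1`, turning `N!` into `(N + 1)!`.
      rw [Finset.sum_congr rfl fun t ht => hterm t (Finset.mem_filter.1 ht).2,
        Finset.sum_filter_of_ne, ← Finset.mul_sum, sum_mul_det_vandermonde_update]
      · have : ∑ i, x i - ∑ j : Fin d, ((j : ℕ) : ℝ) = (N : ℝ) + 1 := by
          simp only [hx, Nat.cast_add, Finset.sum_add_distrib, add_sub_cancel_right]
          exact_mod_cast hN
        rw [this, show rowVandermonde f = (Matrix.vandermonde x).det from rfl,
          Nat.factorial_succ, Nat.cast_mul, Nat.cast_succ]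
        ring
      · intro t _ hne
        by_contra ht
        exact hne (by rw [mul_det_vandermonde_update_eq_zero hf ht, mul_zero])
    · intro t _ t' _ h
      exact Fin.rev_injective (Fin.ext (Prod.mk.injEq _ _ _ _ ▸ h).1)

/-! ### Frobenius' formula for Young diagrams; complements in a rectangle. -/

/-- The lengths of the first `d` rows of `μ`, from row `d - 1` up to row `0`. -/
def revRow (d : ℕ) (μ : YoungDiagram) (i : Fin d) : ℕ := μ.rowLen i.rev

theorem monotone_revRow (d : ℕ) (μ : YoungDiagram) : Monotone (revRow d μ) := fun _ _ h =>
  μ.rowLen_anti _ _ (Fin.rev_le_rev.2 h)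

theorem lt_of_mem_of_colLen_le {d : ℕ} {μ : YoungDiagram} (h : μ.colLen 0 ≤ d) {c : ℕ × ℕ}
    (hc : c ∈ μ) : c.1 < d :=
  ((YoungDiagram.mem_iff_lt_colLen.1 hc).trans_le (μ.colLen_anti 0 c.2 (Nat.zero_le _))).trans_le h

theorem cells_eq_rowCells {d : ℕ} {μ : YoungDiagram} (h : μ.colLen 0 ≤ d) :
    μ.cells = rowCells (revRow d μ) := by
  ext c
  rw [YoungDiagram.mem_cells]
  constructor
  · intro hc
    have hlt := lt_of_mem_of_colLen_le h hc
    refine mem_rowCells.2 ⟨(⟨c.1, hlt⟩ : Fin d).rev, by rw [Fin.rev_rev], ?_⟩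
    rw [revRow, Fin.rev_rev]
    exact YoungDiagram.mem_iff_lt_rowLen.1 hc
  · intro hc
    obtain ⟨i, h1, h2⟩ := mem_rowCells.1 hc
    obtain ⟨a, b⟩ := c
    obtain rfl : a = i.rev := h1
    exact YoungDiagram.mem_iff_lt_rowLen.2 h2

theorem sum_revRow {d : ℕ} {μ : YoungDiagram} (h : μ.colLen 0 ≤ d) :
    ∑ i, revRow d μ i = μ.card := by
  rw [← card_rowCells, ← cells_eq_rowCells h]

theorem revRow_injOn {d : ℕ} {μ ν : YoungDiagram} (hμ : μ.colLen 0 ≤ d) (hν : ν.colLen 0 ≤ d)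
    (h : revRow d μ = revRow d ν) : μ = ν :=
  YoungDiagram.ext (by rw [cells_eq_rowCells hμ, cells_eq_rowCells hν, h])

theorem dim_mul_prod_factorial {d : ℕ} {μ : YoungDiagram} (h : μ.colLen 0 ≤ d) :
    (μ.dim : ℝ) * ∏ i, (factorial (revRow d μ i + i) : ℝ) =
      factorial μ.card * rowVandermonde (revRow d μ) := by
  rw [dim_eq_ncard_fillings, cells_eq_rowCells h]
  exact ncard_fillings_mul_prod_factorial _ _ (monotone_revRow d μ) (sum_revRow h)

theorem one_le_rowVandermonde {d : ℕ} {f : Fin d → ℕ} (hf : Monotone f) :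
    1 ≤ rowVandermonde f := by
  rw [rowVandermonde_eq_prod]
  have h1 : ∀ i j : Fin d, i < j → (1 : ℝ) ≤ ((f j + j : ℕ) : ℝ) - ((f i + i : ℕ) : ℝ) := by
    intro i j hij
    rw [le_sub_iff_add_le]
    have h2 := hf hij.le
    rw [Fin.lt_def] at hij
    exact_mod_cast (by omega : 1 + (f i + i) ≤ f j + j)
  have h2 : ∀ i : Fin d, (1 : ℝ) ≤
      ∏ j ∈ Finset.Ioi i, (((f j + j : ℕ) : ℝ) - ((f i + i : ℕ) : ℝ)) := fun i =>
    Finset.prod_const_one.symm.trans_le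
      (Finset.prod_le_prod (fun _ _ => zero_le_one) fun j hj => h1 i j (Finset.mem_Ioi.1 hj))
  exact Finset.prod_const_one.symm.trans_le
    (Finset.prod_le_prod (fun _ _ => zero_le_one) fun i _ => h2 i)

theorem rowVandermonde_le {d : ℕ} {f : Fin d → ℕ} (hf : Monotone f) {X : ℝ} (hX : 1 ≤ X)
    (h : ∀ i, ((f i + i : ℕ) : ℝ) ≤ X) : rowVandermonde f ≤ X ^ (d * d) := by
  rw [rowVandermonde_eq_prod]
  have h1 : ∀ i : Fin d, ∏ j ∈ Finset.Ioi i, (((f j + j : ℕ) : ℝ) - ((f i + i : ℕ) : ℝ)) ≤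
      X ^ d := by
    intro i
    calc _ ≤ ∏ j ∈ Finset.Ioi i, X := by
          refine Finset.prod_le_prod (fun j hj => ?_) fun j hj => ?_
          · rw [sub_nonneg]
            exact_mod_cast add_le_add (hf (Finset.mem_Ioi.1 hj).le) (Finset.mem_Ioi.1 hj).le
          · exact (sub_le_self _ (Nat.cast_nonneg _)).trans (h j)
      _ = X ^ (Finset.Ioi i).card := by rw [Finset.prod_const]
      _ ≤ X ^ d := pow_le_pow_right₀ hX ((Finset.card_le_univ _).trans_eq (Fintype.card_fin d))
  calc _ ≤ ∏ i : Fin d, X ^ d := by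
        refine Finset.prod_le_prod (fun i _ => Finset.prod_nonneg fun j hj => ?_) fun i _ => h1 i
        rw [sub_nonneg]
        exact_mod_cast add_le_add (hf (Finset.mem_Ioi.1 hj).le) (Finset.mem_Ioi.1 hj).le
    _ = X ^ (d * d) := by rw [Finset.prod_const, Finset.card_univ, Fintype.card_fin, pow_mul]

/-- The nodes undergo the reflection `l ↦ q + d - 1 - l` with their order reversed, so the set of
pairwise differences is only permuted. -/
theorem rowVandermonde_sub_rev {d q : ℕ} {f : Fin d → ℕ} (hf : ∀ i, f i ≤ q) :
    rowVandermonde (fun i => q - f i.rev) = rowVandermonde f := by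
  rw [rowVandermonde_eq_prod, rowVandermonde_eq_prod, Finset.prod_sigma', Finset.prod_sigma']
  refine Finset.prod_bij' (fun p _ => ⟨p.2.rev, p.1.rev⟩) (fun p _ => ⟨p.2.rev, p.1.rev⟩)
    ?_ ?_ ?_ ?_ ?_
  · rintro ⟨i, j⟩ h
    simpa using h
  · rintro ⟨i, j⟩ h
    simpa using h
  · rintro ⟨i, j⟩ h
    simp
  · rintro ⟨i, j⟩ h
    simp
  · rintro ⟨i, j⟩ h
    have hi := i.2
    have hj := j.2
    dsimp only
    rw [Nat.cast_add, Nat.cast_add, Nat.cast_sub (hf _), Nat.cast_sub (hf _), Nat.cast_add,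
      Nat.cast_add, Fin.val_rev, Fin.val_rev, Nat.cast_sub (by omega), Nat.cast_sub (by omega)]
    push_cast
    ring

theorem le_rectangle_iff {d q : ℕ} {μ : YoungDiagram} :
    μ ≤ rectangle d q ↔ μ.colLen 0 ≤ d ∧ ∀ i, revRow d μ i ≤ q := by
  rw [← YoungDiagram.cells_subset_iff]
  constructor
  · intro h
    refine ⟨?_, fun i => ?_⟩
    · by_contra hlt
      have hm : (d, 0) ∈ μ := YoungDiagram.mem_iff_lt_colLen.2 (by omega)
      have := h ((YoungDiagram.mem_cells _).2 hm)
      simp [rectangle] at this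
    · by_contra hlt
      have hm : ((i.rev : ℕ), q) ∈ μ :=
        YoungDiagram.mem_iff_lt_rowLen.2 (by rw [revRow] at hlt; omega)
      have := h ((YoungDiagram.mem_cells _).2 hm)
      simp [rectangle] at this
  · rintro ⟨h1, h2⟩ c hc
    rw [cells_eq_rowCells h1] at hc
    obtain ⟨i, h3, h4⟩ := mem_rowCells.1 hc
    have := h2 i
    have := i.rev.2
    simp only [rectangle, Finset.mem_product, Finset.mem_range]
    omega

theorem revRow_complement (d q : ℕ) (μ : YoungDiagram) (i : Fin d) :
    revRow d (complement d q μ) i = q - revRow d μ i.rev := by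
  rw [revRow, rowLen_complement d q μ i.rev.2, revRow, Fin.rev_rev, Fin.val_rev]
  congr 2
  have := i.2
  omega

theorem complement_le_rectangle (d q : ℕ) (μ : YoungDiagram) :
    complement d q μ ≤ rectangle d q :=
  YoungDiagram.cells_subset_iff.1 (Finset.filter_subset _ _)

theorem complement_complement {d q : ℕ} {μ : YoungDiagram} (h : μ ≤ rectangle d q) :
    complement d q (complement d q μ) = μ := by
  refine revRow_injOn (le_rectangle_iff.1 (complement_le_rectangle _ _ _)).1
    (le_rectangle_iff.1 h).1 (funext fun i => ?_)
  rw [revRow_complement, revRow_complement, Fin.rev_rev]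
  have := (le_rectangle_iff.1 h).2 i
  omega

theorem card_complement {d n : ℕ} {μ : YoungDiagram} (h : μ ≤ rectangle d (2 * n))
    (hc : μ.card = d * n) : (complement d (2 * n) μ).card = d * n := by
  rw [← sum_revRow (le_rectangle_iff.1 (complement_le_rectangle _ _ _)).1]
  have h1 : ∑ i, revRow d (complement d (2 * n) μ) i + ∑ i : Fin d, revRow d μ i.rev
      = ∑ _i : Fin d, 2 * n := by
    rw [← Finset.sum_add_distrib]
    refine Finset.sum_congr rfl fun i _ => ?_
    rw [revRow_complement]
    have := (le_rectangle_iff.1 h).2 i.rev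
    omega
  have h2 : ∑ i : Fin d, revRow d μ i.rev = d * n := by
    rw [← hc, ← sum_revRow (le_rectangle_iff.1 h).1]
    exact Equiv.sum_comp Fin.revPerm (revRow d μ)
  rw [Finset.sum_const, Finset.card_univ, Fintype.card_fin, smul_eq_mul] at h1
  have : d * (2 * n) = d * n + d * n := by ring
  omega

theorem card_rectangle (d q : ℕ) : (rectangle d q).card = d * q := by
  simp [YoungDiagram.card, rectangle]

theorem revRow_rectangle (d q : ℕ) (i : Fin d) : revRow d (rectangle d q) i = q := by
  refine eq_of_forall_lt_iff fun j => ?_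
  rw [revRow, ← YoungDiagram.mem_iff_lt_rowLen, ← YoungDiagram.mem_cells]
  simp only [rectangle, Finset.mem_product, Finset.mem_range, i.rev.2, true_and]

theorem dim_pos {d : ℕ} {μ : YoungDiagram} (h : μ.colLen 0 ≤ d) : (0 : ℝ) < μ.dim := by
  have h1 := dim_mul_prod_factorial h
  have h2 := one_le_rowVandermonde (monotone_revRow d μ)
  have h3 : (0 : ℝ) < ∏ i, (factorial (revRow d μ i + i) : ℝ) :=
    Finset.prod_pos fun i _ => by exact_mod_cast Nat.factorial_pos _
  have h4 : (0 : ℝ) < factorial μ.card * rowVandermonde (revRow d μ) :=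
    mul_pos (by exact_mod_cast Nat.factorial_pos _) (by linarith)
  rw [← h1] at h4
  exact (mul_pos_iff_of_pos_right h3).1 h4

/-! ### Estimates for ratios of factorials. -/

theorem abs_log_one_add_le {x δ : ℝ} (hx : |x| ≤ δ) (hδ : δ ≤ 1 / 2) :
    |Real.log (1 + x)| ≤ 2 * δ := by
  obtain ⟨h1, h2⟩ := abs_le.1 hx
  have hpos : 0 < 1 + x := by linarith
  rw [abs_le]
  constructor
  · refine le_trans ?_ (Real.one_sub_inv_le_log_of_pos hpos)
    rw [le_sub_iff_add_le, ← le_sub_iff_add_le', inv_le_iff_one_le_mul₀ hpos]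
    nlinarith
  · have := Real.log_le_sub_one_of_pos hpos
    linarith

theorem log_factorial_add (b t : ℕ) :
    Real.log (factorial (b + t)) =
      Real.log (factorial b) + ∑ k ∈ Finset.range t, Real.log ((b : ℝ) + 1 + k) := by
  induction t with
  | zero => simp
  | succ t ih =>
    rw [← add_assoc b, Finset.sum_range_succ, ← add_assoc (Real.log _), ← ih,
      Nat.factorial_succ, Nat.cast_mul,
      Real.log_mul (by positivity) (by positivity), add_comm]
    congr 2
    push_cast; ring

/-- Bound for the failure of `log (a! / b!)` to equal `(a - b) log n` when `a + b + 1 = 2 n + d`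
and `|a - b| ≤ T`. -/
noncomputable def factorialError (d n T : ℕ) : ℝ :=
  T * ((d : ℝ) / n + ((T : ℝ) + d) ^ 2 / n ^ 2)

/-- The factors `b + 1, …, a` of `a!/b!` are nearly symmetric about `n`. Pairing the `k`-th smallest
with the `k`-th largest cancels the first-order deviations, except for `d/n`. -/
theorem abs_log_factorial_sub_le_of_le {a b n d T : ℕ} (hn : 0 < n) (hab : a + b + 1 = 2 * n + d)
    (hba : b ≤ a) (hT : a ≤ b + T) (hδ : (d : ℝ) / n + ((T : ℝ) + d) ^ 2 / n ^ 2 ≤ 1 / 2) :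
    |Real.log (factorial a) - Real.log (factorial b) - ((a : ℝ) - b) * Real.log n| ≤
      factorialError d n T := by
  obtain ⟨t, rfl⟩ := Nat.exists_eq_add_of_le hba
  have hn0 : (0 : ℝ) < n := by exact_mod_cast hn
  have hab' : (b : ℝ) + t + b + 1 = 2 * n + d := by exact_mod_cast hab
  have htT : (t : ℝ) ≤ T := by exact_mod_cast (by omega : t ≤ T)
  set δ := (d : ℝ) / n + ((T : ℝ) + d) ^ 2 / n ^ 2 with hδdef
  have hδ0 : 0 ≤ δ := by positivity
  set S := ∑ k ∈ Finset.range t, Real.log ((b : ℝ) + 1 + k) with hS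
  have hrefl : S = ∑ k ∈ Finset.range t, Real.log ((b : ℝ) + t - k) := by
    rw [hS, ← Finset.sum_range_reflect]
    refine Finset.sum_congr rfl fun k hk => ?_
    have hk := Finset.mem_range.1 hk
    congr 1
    rw [Nat.sub_sub, Nat.cast_sub (by omega)]
    push_cast; ring
  have hpair : 2 * (S - t * Real.log n) = ∑ k ∈ Finset.range t,
      (Real.log ((b : ℝ) + 1 + k) + Real.log ((b : ℝ) + t - k) - 2 * Real.log n) := by
    rw [Finset.sum_sub_distrib, Finset.sum_add_distrib, ← hrefl, ← hS, Finset.sum_const,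
      Finset.card_range, nsmul_eq_mul]
    ring
  have hterm : ∀ k ∈ Finset.range t,
      |Real.log ((b : ℝ) + 1 + k) + Real.log ((b : ℝ) + t - k) - 2 * Real.log n| ≤ 2 * δ := by
    intro k hk
    have hk : (k : ℝ) + 1 ≤ t := by exact_mod_cast Finset.mem_range.1 hk
    have hk0 : (0 : ℝ) ≤ k := Nat.cast_nonneg k
    have hb0 : (0 : ℝ) ≤ b := Nat.cast_nonneg b
    have hd0 : (0 : ℝ) ≤ d := Nat.cast_nonneg d
    have hu : (0 : ℝ) < (b : ℝ) + 1 + k := by linarith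
    have hv : (0 : ℝ) < (b : ℝ) + t - k := by linarith
    -- The paired factors `u`, `v` satisfy `u + v = 2n + d`, hence `uv = n^2 + dn + (u - n)(v - n)`.
    have heq : Real.log ((b : ℝ) + 1 + k) + Real.log ((b : ℝ) + t - k) - 2 * Real.log n =
        Real.log (1 + ((d : ℝ) / n + ((b : ℝ) + 1 + k - n) * ((b : ℝ) + t - k - n) / n ^ 2)) := by
      rw [← Real.log_mul hu.ne' hv.ne', show 2 * Real.log (n : ℝ) = Real.log ((n : ℝ) ^ 2) by
        rw [Real.log_pow]; norm_num, ← Real.log_div (by positivity) (by positivity)]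
      congr 1
      have : (d : ℝ) = (b : ℝ) + t + b + 1 - 2 * n := by linarith
      rw [this]
      field_simp
      ring
    rw [heq]
    refine abs_log_one_add_le ?_ hδ
    refine (abs_add_le _ _).trans (add_le_add (abs_of_nonneg (by positivity)).le ?_)
    rw [abs_div, abs_mul, abs_of_pos (by positivity : (0 : ℝ) < (n : ℝ) ^ 2), sq ((T : ℝ) + d)]
    gcongr
    · rw [abs_le]; constructor <;> linarith
    · rw [abs_le]; constructor <;> linarith
  have hsum : |2 * (S - t * Real.log n)| ≤ t * (2 * δ) := by
    rw [hpair]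
    refine (Finset.abs_sum_le_sum_abs _ _).trans ((Finset.sum_le_sum hterm).trans_eq ?_)
    rw [Finset.sum_const, Finset.card_range, nsmul_eq_mul]
  rw [abs_mul, abs_two] at hsum
  rw [log_factorial_add, ← hS, factorialError, ← hδdef,
    show Real.log (factorial b) + S - Real.log (factorial b) -
      (((b + t : ℕ) : ℝ) - b) * Real.log n = S - t * Real.log n by push_cast; ring]
  nlinarith [mul_le_mul_of_nonneg_right htT hδ0]

theorem abs_log_factorial_sub_le {a b n d T : ℕ} (hn : 0 < n) (hab : a + b + 1 = 2 * n + d)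
    (hba : b ≤ a + T) (hT : a ≤ b + T) (hδ : (d : ℝ) / n + ((T : ℝ) + d) ^ 2 / n ^ 2 ≤ 1 / 2) :
    |Real.log (factorial a) - Real.log (factorial b) - ((a : ℝ) - b) * Real.log n| ≤
      factorialError d n T := by
  rcases le_total b a with h | h
  · exact abs_log_factorial_sub_le_of_le hn hab h hT hδ
  · rw [← abs_neg]
    convert abs_log_factorial_sub_le_of_le hn (by omega : b + a + 1 = 2 * n + d) h hba hδ using 2
    ring

theorem log_factorial_sub_le_of_ge (n t : ℕ) (hn : 0 < n) :
    Real.log (factorial n) - Real.log (factorial (n + t)) ≤ -t * Real.log n := by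
  have hn0 : (0 : ℝ) < n := by exact_mod_cast hn
  have h : ∑ _k ∈ Finset.range t, Real.log n ≤
      ∑ k ∈ Finset.range t, Real.log ((n : ℝ) + 1 + k) :=
    Finset.sum_le_sum fun k _ => Real.log_le_log hn0 (by linarith [(Nat.cast_nonneg k : (0:ℝ) ≤ k)])
  rw [Finset.sum_const, Finset.card_range, nsmul_eq_mul] at h
  rw [log_factorial_add]
  linarith

/-- With `n = m + r`, the bound `log x ≤ x - 1` gives each factor `n - j` of `n!/m!` a saving `j/n`;
these add up to `r(r - 1)/(2n)`. -/
theorem log_factorial_sub_le_of_le (m r : ℕ) :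
    Real.log (factorial (m + r)) - Real.log (factorial m) ≤
      r * Real.log (m + r : ℕ) - r * (r - 1) / (2 * (m + r : ℕ)) := by
  rcases Nat.eq_zero_or_pos (m + r) with h0 | hpos
  · obtain ⟨rfl, rfl⟩ : m = 0 ∧ r = 0 := by omega
    simp
  have hn0 : (0 : ℝ) < (m + r : ℕ) := by exact_mod_cast hpos
  set n : ℝ := ((m + r : ℕ) : ℝ) with hn
  have hnn : n = m + r := by rw [hn]; push_cast; ring
  have hterm : ∀ k ∈ Finset.range r, Real.log ((m : ℝ) + 1 + k) ≤
      Real.log n - ((r - 1 - k : ℕ) : ℝ) / n := by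
    intro k hk
    have hk := Finset.mem_range.1 hk
    have hpos' : (0 : ℝ) < (m : ℝ) + 1 + k := by positivity
    have h1 := Real.log_le_sub_one_of_pos (div_pos hpos' hn0)
    rw [Real.log_div hpos'.ne' hn0.ne'] at h1
    have h2 : ((r - 1 - k : ℕ) : ℝ) / n = 1 - ((m : ℝ) + 1 + k) / n := by
      rw [Nat.sub_sub, Nat.cast_sub (by omega)]
      field_simp
      rw [hnn]; push_cast; ring
    linarith
  have hsum := Finset.sum_le_sum hterm
  rw [Finset.sum_sub_distrib, Finset.sum_const, Finset.card_range, nsmul_eq_mul,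
    Finset.sum_range_reflect (fun j => ((j : ℕ) : ℝ) / n), ← Finset.sum_div] at hsum
  have hgauss : (∑ j ∈ Finset.range r, ((j : ℕ) : ℝ)) = r * (r - 1) / 2 := by
    clear * -
    induction r with
    | zero => simp
    | succ r ih => rw [Finset.sum_range_succ, ih]; push_cast; ring
  rw [hgauss, div_div] at hsum
  rw [log_factorial_add]
  linarith

theorem log_factorial_sub_le (n m : ℕ) (hn : 0 < n) :
    Real.log (factorial n) - Real.log (factorial m) ≤ ((n : ℝ) - m) * Real.log n := by
  rcases le_total n m with h | h
  · obtain ⟨t, rfl⟩ := Nat.exists_eq_add_of_le h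
    refine (log_factorial_sub_le_of_ge n t hn).trans_eq ?_
    push_cast; ring
  · obtain ⟨r, rfl⟩ := Nat.exists_eq_add_of_le h
    refine (log_factorial_sub_le_of_le m r).trans ?_
    have : (0 : ℝ) ≤ r * (r - 1) / (2 * (m + r : ℕ)) := by
      refine div_nonneg ?_ (by positivity)
      rcases Nat.eq_zero_or_pos r with rfl | hr
      · simp
      · have : (1 : ℝ) ≤ r := by exact_mod_cast hr
        exact mul_nonneg (by linarith) (by linarith)
    have h2 : (((m + r : ℕ) : ℝ) - m) = r := by push_cast; ring
    rw [h2]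
    linarith

/-- Strictness of the gap gives `r ≥ k + 1` for `r = n - m`, hence `r(r - 1) ≥ k^2`. -/
theorem log_factorial_sub_le_of_add_lt {n m k : ℕ} (h : m + k < n) :
    Real.log (factorial n) - Real.log (factorial m) ≤
      ((n : ℝ) - m) * Real.log n - (k : ℝ) ^ 2 / (2 * n) := by
  obtain ⟨r, rfl⟩ := Nat.exists_eq_add_of_le (show m ≤ n by omega)
  refine (log_factorial_sub_le_of_le m r).trans ?_
  have hk : (k : ℝ) + 1 ≤ r := by exact_mod_cast (by omega : k + 1 ≤ r)
  have hk0 : (0 : ℝ) ≤ k := Nat.cast_nonneg k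
  have h2 : (((m + r : ℕ) : ℝ) - m) = r := by push_cast; ring
  rw [h2]
  gcongr
  nlinarith

/-! ### Dimensions near the rectangle and away from it. -/

theorem log_dim {d : ℕ} {μ : YoungDiagram} (h : μ.colLen 0 ≤ d) :
    Real.log μ.dim = Real.log (factorial μ.card) + Real.log (rowVandermonde (revRow d μ)) -
      ∑ i, Real.log (factorial (revRow d μ i + i)) := by
  have h1 := congrArg Real.log (dim_mul_prod_factorial h)
  have h2 := one_le_rowVandermonde (monotone_revRow d μ)
  rw [Real.log_mul (dim_pos h).ne' (Finset.prod_ne_zero_iff.2 fun i _ => by positivity),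
    Real.log_mul (by positivity) (by linarith), Real.log_prod fun i _ => by positivity] at h1
  linarith

/-- All of the first `d` rows have a length at distance at most `K` from `n`. -/
def IsNearRectangle (d n K : ℕ) (μ : YoungDiagram) : Prop :=
  ∀ i, revRow d μ i ≤ n + K ∧ n ≤ revRow d μ i + K

theorem abs_log_dim_complement_sub_le {d n K : ℕ} {μ : YoungDiagram} (hn : 0 < n)
    (hμ : μ ≤ rectangle d (2 * n)) (hcard : μ.card = d * n) (hK : IsNearRectangle d n K μ)
    (hδ : (d : ℝ) / n + (((2 * K + d : ℕ) : ℝ) + d) ^ 2 / n ^ 2 ≤ 1 / 2) :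
    |Real.log (complement d (2 * n) μ).dim - Real.log μ.dim| ≤
      d * factorialError d n (2 * K + d) := by
  obtain ⟨hcol, hrow⟩ := le_rectangle_iff.1 hμ
  have hcol' := (le_rectangle_iff.1 (complement_le_rectangle d (2 * n) μ)).1
  have hV : rowVandermonde (revRow d (complement d (2 * n) μ)) = rowVandermonde (revRow d μ) := by
    rw [← rowVandermonde_sub_rev hrow]
    exact congrArg _ (funext fun i => revRow_complement d (2 * n) μ i)
  rw [log_dim hcol, log_dim hcol', hV, hcard, card_complement hμ hcard,
    ← Equiv.sum_comp Fin.revPerm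
      (fun i => Real.log (factorial (revRow d (complement d (2 * n) μ) i + i)))]
  simp only [Fin.revPerm_apply, revRow_complement, Fin.rev_rev]
  -- The main terms `(a - b) log n` cancel in total, because `μ` and its complement both have `d n`
  -- cells.
  have hsum : ∑ i : Fin d, (((revRow d μ i + i : ℕ) : ℝ) -
      ((2 * n - revRow d μ i + (i.rev : ℕ) : ℕ) : ℝ)) * Real.log n = 0 := by
    rw [← Finset.sum_mul, Finset.sum_sub_distrib]
    have h1 : ∑ i : Fin d, (revRow d μ i + i) + ∑ i : Fin d, revRow d μ i =
        ∑ i : Fin d, (2 * n - revRow d μ i + (i.rev : ℕ)) + ∑ i : Fin d, revRow d μ i := by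
      rw [← Finset.sum_add_distrib (f := fun i : Fin d => 2 * n - revRow d μ i + (i.rev : ℕ)),
        Finset.sum_add_distrib]
      have h2 : ∑ i : Fin d, (2 * n - revRow d μ i + (i.rev : ℕ) + revRow d μ i) =
          ∑ i : Fin d, (2 * n + (i.rev : ℕ)) :=
        Finset.sum_congr rfl fun i _ => by have := hrow i; omega
      rw [h2, Finset.sum_add_distrib, sum_revRow hcol, hcard, Finset.sum_const, Finset.card_univ,
        Fintype.card_fin, Equiv.sum_comp Fin.revPerm (fun i : Fin d => (i : ℕ)) |>.symm]
      simp only [Fin.revPerm_apply, smul_eq_mul]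
      ring
    have h3 := add_right_cancel h1
    have h4 : ∑ i : Fin d, ((revRow d μ i + i : ℕ) : ℝ) =
        ∑ i : Fin d, ((2 * n - revRow d μ i + (i.rev : ℕ) : ℕ) : ℝ) := by exact_mod_cast h3
    rw [h4, sub_self, zero_mul]
  have hle : ∀ i ∈ (Finset.univ : Finset (Fin d)),
      |Real.log (factorial (revRow d μ i + i)) -
        Real.log (factorial (2 * n - revRow d μ i + (i.rev : ℕ))) -
        (((revRow d μ i + i : ℕ) : ℝ) - ((2 * n - revRow d μ i + (i.rev : ℕ) : ℕ) : ℝ)) *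
          Real.log n| ≤ factorialError d n (2 * K + d) := by
    intro i _
    have h1 := hrow i
    have h2 := hK i
    have h3 := i.2
    have h4 : (i.rev : ℕ) + i + 1 = d := by rw [Fin.val_rev]; omega
    -- Here `a - b = 2 (row - n) + (i - i.rev)`, which explains the tolerance `2K + d`.
    exact abs_log_factorial_sub_le hn (by omega) (by omega) (by omega) hδ
  have hfin := (Finset.abs_sum_le_sum_abs _ _).trans (Finset.sum_le_sum hle)
  rw [Finset.sum_sub_distrib, Finset.sum_sub_distrib, hsum, Finset.sum_const, Finset.card_univ,
    Fintype.card_fin, nsmul_eq_mul] at hfin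
  refine (le_of_eq (congrArg _ ?_)).trans hfin
  ring

theorem log_factorial_add_le {n d i : ℕ} (hid : i < d) :
    Real.log (factorial (n + i)) ≤
      Real.log (factorial n) + d * Real.log (d * (n + 1) : ℕ) := by
  have hX : n + i ≤ d * (n + 1) := by nlinarith
  have hX1 : 1 ≤ d * (n + 1) := by nlinarith
  have h : factorial (n + i) ≤ factorial n * (d * (n + 1)) ^ d := by
    rw [← Nat.factorial_mul_ascFactorial]
    refine Nat.mul_le_mul_left _ ((Nat.ascFactorial_le_pow_add n i).trans ?_)
    exact (Nat.pow_le_pow_left hX i).trans (Nat.pow_le_pow_right hX1 hid.le)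
  have hX0 : (0 : ℝ) < (d * (n + 1) : ℕ) := by exact_mod_cast hX1
  rw [← Real.log_pow, ← Real.log_mul (by positivity) (by positivity)]
  exact Real.log_le_log (by positivity) (by exact_mod_cast h)

/-- If every row had length at least `n - k`, the total `d n` would force each row to be at most `n
+ (d - 1) k`. This is why nearness is measured by `d * k`. -/
theorem exists_short_row {d n k : ℕ} {μ : YoungDiagram} (hcol : μ.colLen 0 ≤ d)
    (hcard : μ.card = d * n) (hK : ¬ IsNearRectangle d n (d * k) μ) :
    ∃ i, revRow d μ i + k < n := by
  by_contra! hall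
  refine hK fun i => ?_
  have hd : 0 < d := i.pos
  have hk : k ≤ d * k := Nat.le_mul_of_pos_left k hd
  refine ⟨?_, by have := hall i; omega⟩
  have h1 : ∑ j ∈ Finset.univ.erase i, n ≤ ∑ j ∈ Finset.univ.erase i, (revRow d μ j + k) :=
    Finset.sum_le_sum fun j _ => hall j
  have h2 := Finset.add_sum_erase Finset.univ (revRow d μ) (Finset.mem_univ i)
  rw [sum_revRow hcol, hcard] at h2
  rw [Finset.sum_add_distrib, Finset.sum_const, Finset.sum_const,
    Finset.card_erase_of_mem (Finset.mem_univ i), Finset.card_univ, Fintype.card_fin] at h1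
  obtain ⟨e, rfl⟩ := Nat.exists_eq_add_of_lt hd
  simp only [smul_eq_mul, zero_add, Nat.add_sub_cancel] at *
  nlinarith

/-- The linear terms `(n - row) log n` sum to zero and the short row `j` saves `k^2/(2n)`. Of the `2
d^2` logarithms, `d^2` bound the Vandermonde product and `d` per row pay for the shifts by `i`
inside the factorials. -/
theorem log_dim_le_of_short_row {d n k : ℕ} {μ : YoungDiagram} (hn : 0 < n)
    (hcol : μ.colLen 0 ≤ d) (hcard : μ.card = d * n) {j : Fin d} (hj : revRow d μ j + k < n) :
    Real.log μ.dim ≤ Real.log (rectangle d n).dim +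
      2 * (d * d) * Real.log (d * (n + 1) : ℕ) - (k : ℝ) ^ 2 / (2 * n) := by
  have hd : 0 < d := j.pos
  set X : ℝ := ((d * (n + 1) : ℕ) : ℝ) with hX
  have hX1 : 1 ≤ X := by
    rw [hX]; exact_mod_cast (by nlinarith : 1 ≤ d * (n + 1))
  have hrcol : (rectangle d n).colLen 0 ≤ d := (le_rectangle_iff.1 le_rfl).1
  have hVr := one_le_rowVandermonde (monotone_revRow d (rectangle d n))
  have hVμ1 := one_le_rowVandermonde (monotone_revRow d μ)
  have hVμ : rowVandermonde (revRow d μ) ≤ X ^ (d * d) := by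
    refine rowVandermonde_le (monotone_revRow d μ) hX1 fun i => ?_
    rw [hX]
    have h1 : revRow d μ i ≤ d * n := by
      rw [← hcard, ← sum_revRow hcol]
      exact Finset.single_le_sum (fun _ _ => Nat.zero_le _) (Finset.mem_univ i)
    have := i.2
    exact_mod_cast (by nlinarith : revRow d μ i + i ≤ d * (n + 1))
  have hlogV : Real.log (rowVandermonde (revRow d μ)) ≤ (d * d : ℕ) * Real.log X := by
    rw [← Real.log_pow]
    exact Real.log_le_log (by linarith) hVμ
  have hlogVr := Real.log_nonneg hVr
  have hterm : ∀ i ∈ (Finset.univ : Finset (Fin d)),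
      Real.log (factorial (n + i)) - Real.log (factorial (revRow d μ i + i)) ≤
        d * Real.log X + ((n : ℝ) - revRow d μ i) * Real.log n -
          if i = j then (k : ℝ) ^ 2 / (2 * n) else 0 := by
    intro i _
    have h1 := log_factorial_add_le (n := n) i.2
    have h2 : Real.log (factorial (revRow d μ i)) ≤ Real.log (factorial (revRow d μ i + i)) :=
      Real.log_le_log (by positivity) (by exact_mod_cast Nat.factorial_le (Nat.le_add_right _ _))
    split_ifs with hij
    · have h3 := log_factorial_sub_le_of_add_lt (hij ▸ hj)
      linarith
    · have h3 := log_factorial_sub_le n (revRow d μ i) hn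
      linarith
  have hsum := Finset.sum_le_sum hterm
  have hzero : ∑ i : Fin d, ((n : ℝ) - revRow d μ i) * Real.log n = 0 := by
    have h1 : ∑ i, (revRow d μ i : ℝ) = d * n := by
      exact_mod_cast (sum_revRow hcol).trans hcard
    rw [← Finset.sum_mul, Finset.sum_sub_distrib, h1]
    simp
  rw [Finset.sum_sub_distrib, Finset.sum_sub_distrib, Finset.sum_add_distrib, hzero,
    Finset.sum_ite_eq' , if_pos (Finset.mem_univ j), Finset.sum_const, Finset.card_univ,
    Fintype.card_fin, nsmul_eq_mul] at hsum
  rw [log_dim hcol, log_dim hrcol, hcard, card_rectangle]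
  simp only [revRow_rectangle] at *
  push_cast at hlogV
  linarith

/-! ### Splitting both sums into near and far parts. -/

/-- The diagrams with `N` cells and at most `d` rows. -/
noncomputable def atMostRows (d N : ℕ) : Finset YoungDiagram :=
  (ofSize N).filter fun l => l.colLen 0 ≤ d

theorem mem_atMostRows {d N : ℕ} {μ : YoungDiagram} :
    μ ∈ atMostRows d N ↔ μ.card = N ∧ μ.colLen 0 ≤ d := by
  rw [atMostRows, Finset.mem_filter, mem_ofSize]

theorem card_atMostRows_le (d N : ℕ) : (atMostRows d N).card ≤ (N + 1) ^ d := by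
  have h : (Fintype.piFinset fun _ : Fin d => Finset.range (N + 1)).card = (N + 1) ^ d := by
    simp
  rw [← h]
  refine Finset.card_le_card_of_injOn (revRow d) (fun μ hμ => ?_) fun μ hμ ν hν hμν => ?_
  · obtain ⟨h1, h2⟩ := mem_atMostRows.1 hμ
    refine Fintype.mem_piFinset.2 fun i => Finset.mem_range.2 (Nat.lt_succ_of_le ?_)
    rw [← h1, ← sum_revRow h2]
    exact Finset.single_le_sum (fun _ _ => Nat.zero_le _) (Finset.mem_univ i)
  · exact revRow_injOn (mem_atMostRows.1 hμ).2 (mem_atMostRows.1 hν).2 hμν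

open Classical in
/-- The part of `dimPowerSum d (d * n) β` over diagrams near the rectangle `R(d, n)`. -/
noncomputable def nearSum (d n K : ℕ) (β : ℝ) : ℝ :=
  ∑ μ ∈ (atMostRows d (d * n)).filter (IsNearRectangle d n K), (μ.dim : ℝ) ^ β

open Classical in
/-- The part of `dimPowerSum d (d * n) β` over diagrams away from the rectangle `R(d, n)`. -/
noncomputable def farSum (d n K : ℕ) (β : ℝ) : ℝ :=
  ∑ μ ∈ (atMostRows d (d * n)).filter (fun μ => ¬ IsNearRectangle d n K μ), (μ.dim : ℝ) ^ β

theorem nearSum_add_farSum (d n K : ℕ) (β : ℝ) :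
    nearSum d n K β + farSum d n K β = dimPowerSum d (d * n) β := by
  classical
  exact Finset.sum_filter_add_sum_filter_not _ _ _

theorem farSum_nonneg (d n K : ℕ) (β : ℝ) : 0 ≤ farSum d n K β :=
  Finset.sum_nonneg fun _ _ => by positivity

theorem rectangle_dim_rpow_le_nearSum (d n K : ℕ) (β : ℝ) :
    ((rectangle d n).dim : ℝ) ^ β ≤ nearSum d n K β := by
  classical
  refine Finset.single_le_sum (f := fun μ : YoungDiagram => (μ.dim : ℝ) ^ β)
    (fun μ _ => by positivity) (Finset.mem_filter.2 ⟨?_, fun i => ?_⟩)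
  · exact mem_atMostRows.2 ⟨card_rectangle d n, (le_rectangle_iff.1 le_rfl).1⟩
  · rw [revRow_rectangle]
    omega

/-- Each far term is compared with the single near term of `R(d, n)`; the summand `d log (d (n +
1))` in the exponent counts the diagrams. -/
theorem farSum_le {d n k : ℕ} (hd : 0 < d) (hn : 0 < n) {β : ℝ} (hβ : 0 ≤ β) :
    farSum d n (d * k) β ≤ Real.exp (d * Real.log (d * (n + 1) : ℕ) +
      β * (2 * (d * d) * Real.log (d * (n + 1) : ℕ) - (k : ℝ) ^ 2 / (2 * n))) *
        nearSum d n (d * k) β := by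
  classical
  have hX1 : 1 ≤ d * (n + 1) := by nlinarith
  set X : ℝ := ((d * (n + 1) : ℕ) : ℝ) with hX
  have hX0 : 0 < X := by rw [hX]; exact_mod_cast hX1
  set M : ℝ := 2 * (d * d) * Real.log X - (k : ℝ) ^ 2 / (2 * n) with hM
  have hrect : (0 : ℝ) < (rectangle d n).dim := dim_pos (le_rectangle_iff.1 le_rfl).1
  have hterm : ∀ μ ∈ (atMostRows d (d * n)).filter (fun μ => ¬ IsNearRectangle d n (d * k) μ),
      (μ.dim : ℝ) ^ β ≤ Real.exp (β * M) * ((rectangle d n).dim : ℝ) ^ β := by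
    intro μ hμ
    obtain ⟨hμ, hfar⟩ := Finset.mem_filter.1 hμ
    obtain ⟨hcard, hcol⟩ := mem_atMostRows.1 hμ
    obtain ⟨j, hj⟩ := exists_short_row hcol hcard hfar
    have h := log_dim_le_of_short_row hn hcol hcard hj
    rw [Real.rpow_def_of_pos (dim_pos hcol), Real.rpow_def_of_pos hrect, ← Real.exp_add]
    refine Real.exp_le_exp.2 ?_
    have h2 : Real.log μ.dim ≤ Real.log (rectangle d n).dim + M := by linarith
    nlinarith [mul_le_mul_of_nonneg_left h2 hβ]
  have hcount : (((atMostRows d (d * n)).filter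
      (fun μ => ¬ IsNearRectangle d n (d * k) μ)).card : ℝ) ≤ Real.exp (d * Real.log X) := by
    rw [mul_comm (d : ℝ), Real.exp_mul, Real.exp_log hX0, Real.rpow_natCast, hX]
    refine (Nat.cast_le.2
      ((Finset.card_filter_le _ _).trans (card_atMostRows_le d (d * n)))).trans ?_
    exact_mod_cast Nat.pow_le_pow_left (by nlinarith : d * n + 1 ≤ d * (n + 1)) d
  refine (Finset.sum_le_card_nsmul _ _ _ hterm).trans ?_
  rw [nsmul_eq_mul, Real.exp_add, mul_assoc]
  have := rectangle_dim_rpow_le_nearSum d n (d * k) β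
  gcongr

open Classical in
/-- The diagrams with `d n` cells contained in `R(d, 2n)`. -/
noncomputable def inRectangle (d n : ℕ) : Finset YoungDiagram :=
  (ofSize (d * n)).filter fun μ => μ ≤ rectangle d (2 * n)

theorem mem_inRectangle {d n : ℕ} {μ : YoungDiagram} :
    μ ∈ inRectangle d n ↔ μ.card = d * n ∧ μ ≤ rectangle d (2 * n) := by
  classical
  rw [inRectangle, Finset.mem_filter, mem_ofSize]

theorem complement_mem_inRectangle {d n : ℕ} {μ : YoungDiagram} (hμ : μ ∈ inRectangle d n) :
    complement d (2 * n) μ ∈ inRectangle d n := by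
  obtain ⟨h1, h2⟩ := mem_inRectangle.1 hμ
  exact mem_inRectangle.2 ⟨card_complement h2 h1, complement_le_rectangle _ _ _⟩

theorem isNearRectangle_complement {d n K : ℕ} {μ : YoungDiagram} (hμ : μ ≤ rectangle d (2 * n))
    (h : IsNearRectangle d n K (complement d (2 * n) μ)) : IsNearRectangle d n K μ := by
  intro i
  have h1 := h i.rev
  have h2 := (le_rectangle_iff.1 hμ).2 i
  rw [revRow_complement, Fin.rev_rev] at h1
  omega

theorem inRectangle_subset_atMostRows (d n : ℕ) : inRectangle d n ⊆ atMostRows d (d * n) := by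
  intro μ hμ
  obtain ⟨h1, h2⟩ := mem_inRectangle.1 hμ
  exact mem_atMostRows.2 ⟨h1, (le_rectangle_iff.1 h2).1⟩

theorem rpow_mul_rpow_le_add {x y α β : ℝ} (hx : 0 < x) (hy : 0 < y) (hα : 0 ≤ α) (hαβ : α ≤ β) :
    x ^ α * y ^ (β - α) ≤ x ^ β + y ^ β := by
  rcases le_total x y with h | h
  · calc x ^ α * y ^ (β - α) ≤ y ^ α * y ^ (β - α) := by gcongr
      _ = y ^ β := by rw [← Real.rpow_add hy, add_sub_cancel]
      _ ≤ x ^ β + y ^ β := le_add_of_nonneg_left (by positivity)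
  · calc x ^ α * y ^ (β - α) ≤ x ^ α * x ^ (β - α) := by
          gcongr
      _ = x ^ β := by rw [← Real.rpow_add hx, add_sub_cancel]
      _ ≤ x ^ β + y ^ β := le_add_of_nonneg_right (by positivity)

-- Each mixed product is at most `(dim μ)^β + (dim μ*)^β`, and complementation is an involution of
-- the far diagrams in the rectangle, so both terms have the same sum.
open Classical in
theorem sum_far_inRectangle_le {d n K : ℕ} {α β : ℝ} (hα : 0 ≤ α) (hαβ : α ≤ β) :
    ∑ μ ∈ (inRectangle d n).filter (fun μ => ¬ IsNearRectangle d n K μ),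
      (μ.dim : ℝ) ^ α * ((complement d (2 * n) μ).dim : ℝ) ^ (β - α) ≤ 2 * farSum d n K β := by
  have hsub : (inRectangle d n).filter (fun μ => ¬ IsNearRectangle d n K μ) ⊆
      (atMostRows d (d * n)).filter (fun μ => ¬ IsNearRectangle d n K μ) :=
    Finset.filter_subset_filter _ (inRectangle_subset_atMostRows d n)
  have h1 : ∑ μ ∈ (inRectangle d n).filter (fun μ => ¬ IsNearRectangle d n K μ),
      (μ.dim : ℝ) ^ β ≤ farSum d n K β :=
    Finset.sum_le_sum_of_subset_of_nonneg hsub fun _ _ _ => by positivity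
  have h2 : ∑ μ ∈ (inRectangle d n).filter (fun μ => ¬ IsNearRectangle d n K μ),
      ((complement d (2 * n) μ).dim : ℝ) ^ β =
      ∑ μ ∈ (inRectangle d n).filter (fun μ => ¬ IsNearRectangle d n K μ), (μ.dim : ℝ) ^ β := by
    have hmem : ∀ μ ∈ (inRectangle d n).filter (fun μ => ¬ IsNearRectangle d n K μ),
        complement d (2 * n) μ ∈
          (inRectangle d n).filter (fun μ => ¬ IsNearRectangle d n K μ) := by
      intro μ hμ
      obtain ⟨hμ, hfar⟩ := Finset.mem_filter.1 hμ
      exact Finset.mem_filter.2 ⟨complement_mem_inRectangle hμ, fun h =>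
        hfar (isNearRectangle_complement (mem_inRectangle.1 hμ).2 h)⟩
    have hinv : ∀ μ ∈ (inRectangle d n).filter (fun μ => ¬ IsNearRectangle d n K μ),
        complement d (2 * n) (complement d (2 * n) μ) = μ := fun μ hμ =>
      complement_complement (mem_inRectangle.1 (Finset.mem_filter.1 hμ).1).2
    exact Finset.sum_bij' (fun μ _ => complement d (2 * n) μ) (fun μ _ => complement d (2 * n) μ)
      hmem hmem hinv hinv fun _ _ => rfl
  have h3 : ∑ μ ∈ (inRectangle d n).filter (fun μ => ¬ IsNearRectangle d n K μ),
      (μ.dim : ℝ) ^ α * ((complement d (2 * n) μ).dim : ℝ) ^ (β - α) ≤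
      ∑ μ ∈ (inRectangle d n).filter (fun μ => ¬ IsNearRectangle d n K μ),
        ((μ.dim : ℝ) ^ β + ((complement d (2 * n) μ).dim : ℝ) ^ β) := by
    refine Finset.sum_le_sum fun μ hμ => ?_
    have hμ' := (mem_inRectangle.1 (Finset.mem_filter.1 hμ).1).2
    exact rpow_mul_rpow_le_add (dim_pos (le_rectangle_iff.1 hμ').1)
      (dim_pos (le_rectangle_iff.1 (complement_le_rectangle d (2 * n) μ)).1) hα hαβ
  rw [Finset.sum_add_distrib, h2] at h3
  linarith

theorem abs_rpow_mul_rpow_sub_le {x y α β η : ℝ} (hx : 0 < x) (hy : 0 < y) (hα : 0 ≤ α)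
    (hαβ : α ≤ β) (h : |Real.log y - Real.log x| ≤ η) :
    |x ^ α * y ^ (β - α) - x ^ β| ≤ (Real.exp (β * η) - 1) * x ^ β := by
  have heq : x ^ α * y ^ (β - α) =
      Real.exp ((β - α) * (Real.log y - Real.log x)) * x ^ β := by
    rw [Real.rpow_def_of_pos hx, Real.rpow_def_of_pos hy, Real.rpow_def_of_pos hx,
      ← Real.exp_add, ← Real.exp_add]
    congr 1
    ring
  set u := (β - α) * (Real.log y - Real.log x) with hu
  have hη : 0 ≤ η := (abs_nonneg _).trans h
  have hu' : |u| ≤ β * η := by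
    rw [hu, abs_mul, abs_of_nonneg (by linarith : 0 ≤ β - α)]
    exact mul_le_mul (by linarith) h (abs_nonneg _) (by linarith)
  have hexp : |Real.exp u - 1| ≤ Real.exp (β * η) - 1 := by
    obtain ⟨h1, h2⟩ := abs_le.1 hu'
    rw [abs_le]
    constructor
    · have h3 := Real.add_one_le_exp u
      have h4 := Real.add_one_le_exp (β * η)
      linarith
    · linarith [Real.exp_le_exp.2 h2]
  rw [heq, ← sub_one_mul, abs_mul, abs_of_pos (Real.rpow_pos_of_pos hx β)]
  gcongr

/-- The near parts run over the same diagrams, since `d * k ≤ n` keeps every near diagram inside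
`R(d, 2n)`. The factor 3 counts the far part once for `dimPowerSum` and twice for
`rectanglePowerSum`. -/
theorem abs_rectanglePowerSum_sub_dimPowerSum_le {d n k : ℕ} (hd : 0 < d) (hn : 0 < n)
    (hk : d * k ≤ n) {α β : ℝ} (hα : 0 ≤ α) (hαβ : α ≤ β)
    (hδ : (d : ℝ) / n + (((2 * (d * k) + d : ℕ) : ℝ) + d) ^ 2 / n ^ 2 ≤ 1 / 2) :
    |rectanglePowerSum d n α β - dimPowerSum d (d * n) β| ≤
      (Real.exp (β * (d * factorialError d n (2 * (d * k) + d))) - 1 +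
        3 * Real.exp (d * Real.log (d * (n + 1) : ℕ) +
          β * (2 * (d * d) * Real.log (d * (n + 1) : ℕ) - (k : ℝ) ^ 2 / (2 * n)))) *
        dimPowerSum d (d * n) β := by
  classical
  have hβ : 0 ≤ β := hα.trans hαβ
  set η := d * factorialError d n (2 * (d * k) + d) with hηdef
  set ε := Real.exp (d * Real.log (d * (n + 1) : ℕ) +
    β * (2 * (d * d) * Real.log (d * (n + 1) : ℕ) - (k : ℝ) ^ 2 / (2 * n))) with hε
  have hfar : farSum d n (d * k) β ≤ ε * nearSum d n (d * k) β := farSum_le hd hn hβ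
  have hnear : (inRectangle d n).filter (IsNearRectangle d n (d * k)) =
      (atMostRows d (d * n)).filter (IsNearRectangle d n (d * k)) := by
    refine (Finset.filter_subset_filter _ (inRectangle_subset_atMostRows d n)).antisymm ?_
    intro μ hμ
    obtain ⟨hμ, hK⟩ := Finset.mem_filter.1 hμ
    obtain ⟨h1, h2⟩ := mem_atMostRows.1 hμ
    refine Finset.mem_filter.2 ⟨mem_inRectangle.2 ⟨h1, le_rectangle_iff.2 ⟨h2, fun i => ?_⟩⟩, hK⟩
    have := hK i
    omega
  set F : YoungDiagram → ℝ := fun μ =>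
    (μ.dim : ℝ) ^ α * ((complement d (2 * n) μ).dim : ℝ) ^ (β - α) with hF
  have hsplit : rectanglePowerSum d n α β =
      ∑ μ ∈ (inRectangle d n).filter (IsNearRectangle d n (d * k)), F μ +
      ∑ μ ∈ (inRectangle d n).filter (fun μ => ¬ IsNearRectangle d n (d * k) μ), F μ :=
    (Finset.sum_filter_add_sum_filter_not _ _ _).symm
  have hfar' : ∑ μ ∈ (inRectangle d n).filter (fun μ => ¬ IsNearRectangle d n (d * k) μ), F μ ≤
      2 * farSum d n (d * k) β := sum_far_inRectangle_le hα hαβ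
  have hfar0 : 0 ≤ ∑ μ ∈ (inRectangle d n).filter
      (fun μ => ¬ IsNearRectangle d n (d * k) μ), F μ :=
    Finset.sum_nonneg fun _ _ => by positivity
  have hmain : |∑ μ ∈ (inRectangle d n).filter (IsNearRectangle d n (d * k)), F μ -
      nearSum d n (d * k) β| ≤ (Real.exp (β * η) - 1) * nearSum d n (d * k) β := by
    rw [nearSum, ← hnear, ← Finset.sum_sub_distrib, Finset.mul_sum]
    refine (Finset.abs_sum_le_sum_abs _ _).trans (Finset.sum_le_sum fun μ hμ => ?_)
    obtain ⟨hμ, hK⟩ := Finset.mem_filter.1 hμ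
    obtain ⟨h1, h2⟩ := mem_inRectangle.1 hμ
    exact abs_rpow_mul_rpow_sub_le (dim_pos (le_rectangle_iff.1 h2).1)
      (dim_pos (le_rectangle_iff.1 (complement_le_rectangle d (2 * n) μ)).1) hα hαβ
      (abs_log_dim_complement_sub_le hn h2 h1 hK hδ)
  have hη : 0 ≤ η := by rw [hηdef, factorialError]; positivity
  have hcoef : 0 ≤ Real.exp (β * η) - 1 + 3 * ε := by
    have := Real.one_le_exp (mul_nonneg hβ hη)
    have := Real.exp_pos (d * Real.log (d * (n + 1) : ℕ) +
      β * (2 * (d * d) * Real.log (d * (n + 1) : ℕ) - (k : ℝ) ^ 2 / (2 * n)))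
    rw [← hε] at this
    linarith
  have hle : nearSum d n (d * k) β ≤ dimPowerSum d (d * n) β := by
    rw [← nearSum_add_farSum d n (d * k) β]
    linarith [farSum_nonneg d n (d * k) β]
  refine le_trans ?_ (mul_le_mul_of_nonneg_left hle hcoef)
  rw [hsplit, ← nearSum_add_farSum d n (d * k) β]
  have h0 := farSum_nonneg d n (d * k) β
  obtain ⟨h1, h2⟩ := abs_le.1 hmain
  rw [abs_le]
  constructor <;> nlinarith

/-! ### Choice of the tolerance and limits of the error terms. -/

theorem tendsto_exp_log_sub_nhds_zero (d : ℕ) (hd : 0 < d) (Q c : ℝ) (hQ : 0 ≤ Q) (hc : 0 < c) :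
    Tendsto (fun n : ℕ => Real.exp (Q * Real.log (d * (n + 1) : ℕ) - c * (n : ℝ) ^ (1 / 5 : ℝ)))
      atTop (nhds 0) := by
  have hy : Tendsto (fun n : ℕ => (n : ℝ) ^ (1 / 5 : ℝ)) atTop atTop :=
    (tendsto_rpow_atTop (by norm_num)).comp tendsto_natCast_atTop_atTop
  have h1 := ((tendsto_rpow_mul_exp_neg_mul_atTop_nhds_zero (5 * Q) c hc).comp hy).const_mul
    (Real.exp (Q * Real.log (2 * d)))
  rw [mul_zero] at h1
  refine squeeze_zero' (Eventually.of_forall fun _ => (Real.exp_pos _).le) ?_ h1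
  filter_upwards [eventually_gt_atTop 0] with n hn
  have hn0 : (0 : ℝ) < n := by exact_mod_cast hn
  have hd0 : (0 : ℝ) < d := by exact_mod_cast hd
  have hlog : Real.log (d * (n + 1) : ℕ) ≤ Real.log (2 * d) + Real.log n := by
    rw [← Real.log_mul (by positivity) (by positivity)]
    refine Real.log_le_log (by positivity) ?_
    have : d * (n + 1) ≤ 2 * d * n := by nlinarith
    exact_mod_cast this
  rw [Function.comp_apply, ← Real.rpow_mul hn0.le, Real.rpow_def_of_pos hn0 (1 / 5 * (5 * Q)),
    ← Real.exp_add, ← Real.exp_add]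
  refine Real.exp_le_exp.2 ?_
  nlinarith [mul_le_mul_of_nonneg_left hlog hQ]

/-- The tolerance, in units of `d` cells per row, up to which a row of a diagram counts as close
to the average length `n`. -/
noncomputable def rowTolerance (n : ℕ) : ℕ := ⌈(n : ℝ) ^ (3 / 5 : ℝ)⌉₊

/-- In terms of `y = n^(1/5)` all later estimates involve only integer powers. -/
theorem exists_fifth_root {n : ℕ} (hn : 0 < n) : ∃ y : ℝ, y = (n : ℝ) ^ (1 / 5 : ℝ) ∧ 1 ≤ y ∧
    (n : ℝ) = y ^ 5 ∧ y ^ 3 ≤ rowTolerance n ∧ (rowTolerance n : ℝ) ≤ 2 * y ^ 3 := by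
  have hn1 : (1 : ℝ) ≤ n := by exact_mod_cast hn
  have hn0 : (0 : ℝ) ≤ n := by linarith
  have hy1 : (1 : ℝ) ≤ (n : ℝ) ^ (1 / 5 : ℝ) := Real.one_le_rpow hn1 (by norm_num)
  have h3 : (n : ℝ) ^ (3 / 5 : ℝ) = ((n : ℝ) ^ (1 / 5 : ℝ)) ^ 3 := by
    rw [← Real.rpow_natCast, ← Real.rpow_mul hn0]; norm_num
  have h5 : (n : ℝ) = ((n : ℝ) ^ (1 / 5 : ℝ)) ^ 5 := by
    rw [← Real.rpow_natCast, ← Real.rpow_mul hn0]; norm_num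
  refine ⟨_, rfl, hy1, h5, h3 ▸ Nat.le_ceil _, ?_⟩
  have h := (Nat.ceil_lt_add_one (Real.rpow_nonneg hn0 (3 / 5))).le
  rw [h3] at h
  rw [rowTolerance, h3]
  linarith [one_le_pow₀ hy1 (n := 3)]

theorem tolerance_bound {d n : ℕ} (hd : 0 < d) (hn : 0 < n) :
    (d : ℝ) / n + (((2 * (d * rowTolerance n) + d : ℕ) : ℝ) + d) ^ 2 / n ^ 2 ≤
      37 * d ^ 2 * (((n : ℝ) ^ (1 / 5 : ℝ)) ^ 4)⁻¹ := by
  obtain ⟨y, hy, hy1, hn5, -, hk⟩ := exists_fifth_root hn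
  rw [← hy, hn5]
  set k : ℝ := (rowTolerance n : ℝ)
  have hy0 : 0 < y := by linarith
  have hd1 : (1 : ℝ) ≤ d := by exact_mod_cast hd
  have hy3 : 1 ≤ y ^ 3 := one_le_pow₀ hy1
  -- The left side is at most `4 d y^3 + 2 d`. Its square gives 36 of the constant 37, and `d/n`
  -- gives the remaining 1.
  have h1 : ((2 * (d * rowTolerance n) + d : ℕ) : ℝ) + d ≤ 6 * d * y ^ 3 := by
    push_cast
    nlinarith [mul_le_mul_of_nonneg_left hk (by linarith : (0 : ℝ) ≤ d)]
  have h2 : (((2 * (d * rowTolerance n) + d : ℕ) : ℝ) + d) ^ 2 ≤ (6 * d * y ^ 3) ^ 2 := by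
    gcongr
  have h3 : (d : ℝ) / y ^ 5 ≤ d ^ 2 * (y ^ 4)⁻¹ := by
    rw [div_eq_mul_inv]
    have : (y ^ 5)⁻¹ ≤ (y ^ 4)⁻¹ := inv_anti₀ (by positivity) (pow_le_pow_right₀ hy1 (by norm_num))
    have : (d : ℝ) ≤ d ^ 2 := by nlinarith
    gcongr
  have h4 : (((2 * (d * rowTolerance n) + d : ℕ) : ℝ) + d) ^ 2 / (y ^ 5) ^ 2 ≤
      36 * d ^ 2 * (y ^ 4)⁻¹ := by
    refine (div_le_div_of_nonneg_right h2 (by positivity)).trans_eq ?_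
    field_simp
    ring
  linarith

theorem factorialError_le {d n : ℕ} (hd : 0 < d) (hn : 0 < n) :
    factorialError d n (2 * (d * rowTolerance n) + d) ≤
      185 * d ^ 3 * ((n : ℝ) ^ (1 / 5 : ℝ))⁻¹ := by
  obtain ⟨y, hy, hy1, hn5, -, hk⟩ := exists_fifth_root hn
  have h := tolerance_bound hd hn
  have hy0 : 0 < y := by linarith
  have hd1 : (1 : ℝ) ≤ d := by exact_mod_cast hd
  have hy3 : 1 ≤ y ^ 3 := one_le_pow₀ hy1
  rw [factorialError]
  rw [← hy] at h ⊢
  have h1 : ((2 * (d * rowTolerance n) + d : ℕ) : ℝ) ≤ 5 * d * y ^ 3 := by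
    push_cast
    nlinarith [mul_le_mul_of_nonneg_left hk (by linarith : (0 : ℝ) ≤ d)]
  refine (mul_le_mul h1 h (by positivity) (by positivity)).trans_eq ?_
  field_simp
  ring

theorem tendsto_fifth_root_inv_pow (m : ℕ) (hm : m ≠ 0) :
    Tendsto (fun n : ℕ => (((n : ℝ) ^ (1 / 5 : ℝ)) ^ m)⁻¹) atTop (nhds 0) :=
  ((tendsto_pow_atTop hm).comp ((tendsto_rpow_atTop (by norm_num)).comp
    tendsto_natCast_atTop_atTop)).inv_tendsto_atTop

theorem eventually_mul_rowTolerance_le (d : ℕ) : ∀ᶠ n : ℕ in atTop, d * rowTolerance n ≤ n := by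
  have h := (tendsto_fifth_root_inv_pow 2 two_ne_zero).const_mul (2 * (d : ℝ))
  rw [mul_zero] at h
  filter_upwards [h.eventually_le_const one_pos, eventually_gt_atTop 0] with n h1 hn
  obtain ⟨y, hy, hy1, hn5, -, hk⟩ := exists_fifth_root hn
  rw [← hy, ← div_eq_mul_inv, div_le_one (by positivity)] at h1
  have hd0 : (0 : ℝ) ≤ d := Nat.cast_nonneg d
  have : (d : ℝ) * rowTolerance n ≤ n := by
    rw [hn5]
    calc (d : ℝ) * rowTolerance n ≤ d * (2 * y ^ 3) := by gcongr
      _ = (2 * d) * y ^ 3 := by ring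
      _ ≤ y ^ 2 * y ^ 3 := by gcongr
      _ = y ^ 5 := by ring
  exact_mod_cast this

theorem eventually_tolerance_bound_le (d : ℕ) (hd : 0 < d) : ∀ᶠ n : ℕ in atTop,
    (d : ℝ) / n + (((2 * (d * rowTolerance n) + d : ℕ) : ℝ) + d) ^ 2 / n ^ 2 ≤ 1 / 2 := by
  have h := (tendsto_fifth_root_inv_pow 4 four_ne_zero).const_mul (37 * (d : ℝ) ^ 2)
  rw [mul_zero] at h
  filter_upwards [h.eventually_le_const one_half_pos, eventually_gt_atTop 0] with n h1 hn
  exact (tolerance_bound hd hn).trans h1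

theorem tendsto_relative_error (d : ℕ) (hd : 0 < d) {β : ℝ} (hβ : 0 < β) :
    Tendsto (fun n : ℕ =>
      Real.exp (β * (d * factorialError d n (2 * (d * rowTolerance n) + d))) - 1 +
        3 * Real.exp (d * Real.log (d * (n + 1) : ℕ) + β * (2 * (d * d) *
          Real.log (d * (n + 1) : ℕ) - (rowTolerance n : ℝ) ^ 2 / (2 * n)))) atTop (nhds 0) := by
  have h1 : Tendsto (fun n : ℕ => factorialError d n (2 * (d * rowTolerance n) + d))
      atTop (nhds 0) := by
    have h := (tendsto_fifth_root_inv_pow 1 one_ne_zero).const_mul (185 * (d : ℝ) ^ 3)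
    rw [mul_zero] at h
    refine squeeze_zero' (Eventually.of_forall fun n => by rw [factorialError]; positivity) ?_ h
    filter_upwards [eventually_gt_atTop 0] with n hn
    rw [pow_one]
    exact factorialError_le hd hn
  have h2 : Tendsto (fun n : ℕ =>
      Real.exp (β * (d * factorialError d n (2 * (d * rowTolerance n) + d))) - 1)
      atTop (nhds 0) := by
    have h := (Real.continuous_exp.tendsto _).comp ((h1.const_mul (d : ℝ)).const_mul β)
    simpa using h.sub_const 1
  have h3 : Tendsto (fun n : ℕ => Real.exp (d * Real.log (d * (n + 1) : ℕ) + β * (2 * (d * d) *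
      Real.log (d * (n + 1) : ℕ) - (rowTolerance n : ℝ) ^ 2 / (2 * n)))) atTop (nhds 0) := by
    refine squeeze_zero' (Eventually.of_forall fun _ => (Real.exp_pos _).le) ?_
      (tendsto_exp_log_sub_nhds_zero d hd (d + β * (2 * (d * d))) (β / 2) (by positivity)
        (by positivity))
    filter_upwards [eventually_gt_atTop 0] with n hn
    obtain ⟨y, hy, hy1, hn5, hk, -⟩ := exists_fifth_root hn
    refine Real.exp_le_exp.2 ?_
    have hy0 : 0 < y := by linarith
    -- The Gaussian saving is at least `n^(1/5)/2`, whence the rate `β / 2` above.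
    have h4 : y / 2 ≤ (rowTolerance n : ℝ) ^ 2 / (2 * n) := by
      rw [hn5, div_le_div_iff₀ (by norm_num) (by positivity)]
      calc y * (2 * y ^ 5) = (y ^ 3) ^ 2 * 2 := by ring
        _ ≤ (rowTolerance n : ℝ) ^ 2 * 2 := by gcongr
    rw [← hy]
    nlinarith [mul_le_mul_of_nonneg_left h4 hβ.le]
  simpa using h2.add (h3.const_mul 3)

end YoungDiagram

theorem mainTheorem2 (d : ℕ) (hd : 2 ≤ d) (α β : ℝ) (hβ : 0 < β) (hα : 0 ≤ α) (hαβ : α ≤ β) :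
    (fun n : ℕ => YoungDiagram.dimPowerSum d (d * n) β) ~[atTop]
      (fun n : ℕ => YoungDiagram.rectanglePowerSum d n α β) := by
  have hd0 : 0 < d := by omega
  -- The error bound is relative to `dimPowerSum`, so the equivalence is proved in the reverse
  -- direction.
  refine IsEquivalent.symm (IsLittleO.of_bound fun c hc => ?_)
  filter_upwards [eventually_gt_atTop 0, YoungDiagram.eventually_mul_rowTolerance_le d,
    YoungDiagram.eventually_tolerance_bound_le d hd0,
    (YoungDiagram.tendsto_relative_error d hd0 hβ).eventually_le_const hc] with n hn hk hδ hε
  have h0 : 0 ≤ YoungDiagram.dimPowerSum d (d * n) β := Finset.sum_nonneg fun _ _ => by positivity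
  rw [Pi.sub_apply, Real.norm_eq_abs, Real.norm_eq_abs, abs_of_nonneg h0]
  exact (YoungDiagram.abs_rectanglePowerSum_sub_dimPowerSum_le hd0 hn hk hα hαβ hδ).trans
    (mul_le_mul_of_nonneg_right hε h0)
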